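/- Let $\mathcal M$ be a weakly topological structure, i.e. a one-sorted first-order structure whose underlying set $M$ carries a topology; every power $M^n$ carries the product topology, and "definable" means definable with parameters from $M$. A generalized topological space (gts) is a set with a family of open subsets and a family of admissible families of open sets satisfying the Delfs–Knebusch axioms: $\emptyset$ and the whole space are open, finite unions and intersections of open sets are open, finite open families are admissible, unions of admissible families are open, and stability, transitivity, saturation and regularity hold. A map is strictly continuous if preimages of admissible families are admissible. A space over $\mathcal M$ is a gts with a sheaf (for admissible coverings) of sets of $M$-valued functions whose restrictions are the set-theoretic ones; morphisms are the strictly continuous maps that pull sections back to sections. A definable set $D\subseteq M^n$ is a space over $\mathcal M$: the open sets are the relatively open definable subsets, the admissible families are the open families with a finite subfamily having the same union, and the sections are the continuous definable $M$-valued functions. A space is affine definable if it is isomorphic to such a $D$; such an isomorphism is called a chart. A space is locally definable if it has an admissible covering by affine definable open subspaces. Let $\mathbf{LDS}(\mathcal M)$ be the full subcategory of locally definable spaces. A subset $S$ of a locally definable space $X$ is locally definable if for every chart $\varphi:U\cong D\subseteq M^n$ of an affine definable open subspace $U\subseteq X$ the set $\varphi(S\cap U)$ is definable. A morphism $i:W\to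 X$ in $\mathbf{LDS}(\mathcal M)$ identifies $W$ with the subspace $S$ if $i$ is injective with image $S$, the set $S$ is locally definable, and for every such chart the map $\varphi\circ i$ is an isomorphism from the open subspace $i^{-1}(U)$ of $W$ onto the definable set $\varphi(S\cap U)$ with its structure of a space over $\mathcal M$. **Theorem.** 1. The category $\mathbf{LDS}(\mathcal M)$ is finitely complete. 2. Let $X,Y$ be locally definable spaces with admissible coverings $\mathcal U$, $\mathcal V$ by affine definable open subspaces. A locally definable space $P$ with morphisms $p_1:P\to X$, $p_2:P\to Y$ is a product of $X$ and $Y$ in $\mathbf{LDS}(\mathcal M)$ if and only if it is the admissible union of the products $U\times V$ ($U\in\mathcal U$, $V\in\mathcal V$) of affine definable open subspaces, that is: $(p_1,p_2)$ is a bijection from $P$ onto the set $X\times Y$; the open sets $p_1^{-1}(U)\cap p_2^{-1}(V)$ form an admissible covering of $P$; and for all $U\in\mathcal U$, $V\in\mathcal V$ and all charts $\varphi:U\cong D\subseteq M^n$, $\psi:V\cong E\subseteq M^m$, the map $(\varphi\circ p_1,\psi\circ p_2)$ is an isomorphism of the open subspace $p_1^{-1}(U)\cap p_2^{-1}(V)$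 onto the definable set $D\times E\subseteq M^{n+m}$ with its structure of a space over $\mathcal M$. 3. Let $f:X\to Z$ and $g:Y\to Z$ be morphisms of locally definable spaces, let $X\times Y$ and $Z\times Z$ be products in $\mathbf{LDS}(\mathcal M)$, and let $\Delta_Z\subseteq Z\times Z$ be the diagonal. Then $\Delta_Z$ and $(f\times g)^{-1}(\Delta_Z)\subseteq X\times Y$ are locally definable subsets, and a morphism $i:W\to X\times Y$ in $\mathbf{LDS}(\mathcal M)$ makes $W$, with the two components of $i$, a fiber product of $f$ and $g$ if and only if $i$ identifies $W$ with the subspace $(f\times g)^{-1}(\Delta_Z)$. -/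

import Mathlib

open CategoryTheory CategoryTheory.Limits

universe u v w

namespace LocDef

/-! ### Generalized topological spaces -/

/-- A generalized topology (in the sense of Delfs and Knebusch) on a set `X`: open sets together
with admissible families of open sets (each regarded as a covering of its own union). -/
structure GenTop (X : Type u) where
  IsOpen : Set X → Prop
  Adm : Set (Set X) → Prop
  isOpen_of_mem : ∀ ⦃𝒰 : Set (Set X)⦄, Adm 𝒰 → ∀ ⦃U⦄, U ∈ 𝒰 → IsOpen U
  isOpen_empty : IsOpen ∅
  isOpen_univ : IsOpen Set.univ
  isOpen_union : ∀ ⦃U V⦄, IsOpen U → IsOpen V → IsOpen (U ∪ V)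
  isOpen_inter : ∀ ⦃U V⦄, IsOpen U → IsOpen V → IsOpen (U ∩ V)
  /-- Finite open families are admissible. -/
  adm_of_finite : ∀ ⦃𝒰 : Set (Set X)⦄, 𝒰.Finite → (∀ U ∈ 𝒰, IsOpen U) → Adm 𝒰
  /-- The union of an admissible family is open. -/
  isOpen_sUnion : ∀ ⦃𝒰 : Set (Set X)⦄, Adm 𝒰 → IsOpen (⋃₀ 𝒰)
  /-- Stability. -/
  adm_inter : ∀ ⦃V : Set X⦄ ⦃𝒰 : Set (Set X)⦄, IsOpen V → Adm 𝒰 → Adm ((fun U => V ∩ U) '' 𝒰)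
  /-- Transitivity. -/
  adm_trans : ∀ ⦃Φ : Set (Set (Set X))⦄, (∀ 𝒱 ∈ Φ, Adm 𝒱) → Adm (Set.sUnion '' Φ) → Adm (⋃₀ Φ)
  /-- Saturation: a coarsening, with the same union, of an admissible family is admissible. -/
  adm_coarsen : ∀ ⦃𝒰 𝒱 : Set (Set X)⦄, Adm 𝒰 → (∀ V ∈ 𝒱, IsOpen V) → ⋃₀ 𝒰 = ⋃₀ 𝒱 →
    (∀ U ∈ 𝒰, ∃ V ∈ 𝒱, U ⊆ V) → Adm 𝒱
  /-- Regularity. -/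
  isOpen_of_inter : ∀ ⦃W : Set X⦄ ⦃𝒰 : Set (Set X)⦄, Adm 𝒰 → W ⊆ ⋃₀ 𝒰 →
    (∀ U ∈ 𝒰, IsOpen (W ∩ U)) → IsOpen W

/-! ### Spaces over a structure -/

/-- A space over `M`: a generalized topological space with a function sheaf over `M`, that is, a
sheaf (for admissible coverings) of sets of `M`-valued functions with set-theoretic restrictions.
For such a presheaf of functions the sheaf property says exactly that a function on the union of an
admissible family is a section as soon as its restrictions to the members are sections. -/
structure Space (M : Type u) where
  carrier : Type u
  top : GenTop carrier
  sections : ∀ U : Set carrier, top.IsOpen U → Set (U → M)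
  res_mem : ∀ ⦃U V : Set carrier⦄ (hU : top.IsOpen U) (hV : top.IsOpen V) (hVU : V ⊆ U),
    ∀ s ∈ sections U hU, s ∘ Set.inclusion hVU ∈ sections V hV
  glue_mem : ∀ ⦃𝒰 : Set (Set carrier)⦄ (h𝒰 : top.Adm 𝒰) (s : ↥(⋃₀ 𝒰) → M),
    (∀ (U : Set carrier) (hU : U ∈ 𝒰),
      s ∘ Set.inclusion (Set.subset_sUnion_of_mem hU) ∈ sections U (top.isOpen_of_mem h𝒰 hU)) →
    s ∈ sections (⋃₀ 𝒰) (top.isOpen_sUnion h𝒰)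

namespace Space

variable {M : Type u}

instance : CoeSort (Space M) (Type u) := ⟨Space.carrier⟩

/-- Strict continuity: preimages of admissible families are admissible. -/
def StrictlyContinuous {X Y : Space M} (f : X → Y) : Prop :=
  ∀ 𝒱 : Set (Set Y), Y.top.Adm 𝒱 → X.top.Adm ((fun V => f ⁻¹' V) '' 𝒱)

theorem StrictlyContinuous.isOpen_preimage {X Y : Space M} {f : X → Y}
    (hf : StrictlyContinuous f) {V : Set Y} (hV : Y.top.IsOpen V) : X.top.IsOpen (f ⁻¹' V) := by
  have h := hf {V} (Y.top.adm_of_finite (Set.finite_singleton V) (by simpa using hV))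
  exact X.top.isOpen_of_mem h ⟨V, rfl, rfl⟩

/-- Morphisms of spaces over `M`: strictly continuous maps pulling sections back to sections. -/
@[ext]
structure Hom (X Y : Space M) where
  toFun : X → Y
  strict : StrictlyContinuous toFun
  comp_mem : ∀ (V : Set Y) (hV : Y.top.IsOpen V), ∀ s ∈ Y.sections V hV,
    s ∘ V.restrictPreimage toFun ∈ X.sections (toFun ⁻¹' V) (strict.isOpen_preimage hV)

theorem sections_congr (X : Space M) {U V : Set X} (h : U = V) (hU : X.top.IsOpen U)
    (hV : X.top.IsOpen V) {s : U → M} {t : V → M} (hst : ∀ x hx hx', s ⟨x, hx⟩ = t ⟨x, hx'⟩)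
    (hs : s ∈ X.sections U hU) : t ∈ X.sections V hV := by
  subst h
  have : s = t := funext fun x => hst x.1 x.2 x.2
  exact this ▸ hs

instance : Category (Space M) where
  Hom X Y := Hom X Y
  id X :=
    { toFun := id
      strict := fun 𝒱 h𝒱 => by simpa using h𝒱
      comp_mem := fun V hV s hs => hs }
  comp {X Y Z} f g :=
    { toFun := g.toFun ∘ f.toFun
      strict := fun 𝒱 h𝒱 => by
        have h := f.strict _ (g.strict _ h𝒱)
        rw [Set.image_image] at h
        exact h
      comp_mem := fun V hV s hs =>
        f.comp_mem _ (g.strict.isOpen_preimage hV) _ (g.comp_mem V hV s hs) }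

/-! ### Open subspaces -/

theorem sUnion_image_val {X : Type u} {U : Set X} (𝒱 : Set (Set U)) :
    ⋃₀ ((fun V : Set U => (Subtype.val '' V : Set X)) '' 𝒱) = Subtype.val '' (⋃₀ 𝒱) := by
  rw [Set.sUnion_image, Set.sUnion_eq_biUnion, Set.image_iUnion₂]

/-- The generalized topology of an open subspace. As `U` is open, the traces on `U` of open sets
(of admissible families) are exactly the subsets of `U` (the families of subsets of `U`) which are
open (admissible) in the whole space. -/
def restrictTop {X : Type u} (T : GenTop X) (U : Set X) (hU : T.IsOpen U) : GenTop U where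
  IsOpen V := T.IsOpen (Subtype.val '' V)
  Adm 𝒱 := T.Adm ((fun V : Set U => (Subtype.val '' V : Set X)) '' 𝒱)
  isOpen_of_mem 𝒱 h𝒱 V hV := T.isOpen_of_mem h𝒱 ⟨V, hV, rfl⟩
  isOpen_empty := by simpa using T.isOpen_empty
  isOpen_univ := by simpa using hU
  isOpen_union V W hV hW := by
    rw [Set.image_union]; exact T.isOpen_union hV hW
  isOpen_inter V W hV hW := by
    rw [Set.image_inter Subtype.val_injective]; exact T.isOpen_inter hV hW
  adm_of_finite 𝒱 hfin hop := T.adm_of_finite (hfin.image _) (by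
    rintro _ ⟨V, hV, rfl⟩; exact hop V hV)
  isOpen_sUnion 𝒱 h𝒱 := by
    rw [← sUnion_image_val]; exact T.isOpen_sUnion h𝒱
  adm_inter V 𝒱 hV h𝒱 := by
    have h := T.adm_inter hV h𝒱
    rw [Set.image_image] at h ⊢
    simpa only [Set.image_inter Subtype.val_injective] using h
  adm_trans Φ hΦ hΦ' := by
    have h := T.adm_trans (Φ := (fun 𝒱 : Set (Set U) =>
      (fun V : Set U => (Subtype.val '' V : Set X)) '' 𝒱) '' Φ)
      (by rintro _ ⟨𝒱, h𝒱, rfl⟩; exact hΦ 𝒱 h𝒱)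
      (by
        rw [Set.image_image] at hΦ' ⊢
        simpa only [sUnion_image_val] using hΦ')
    rwa [Set.sUnion_image, ← Set.image_iUnion₂, ← Set.sUnion_eq_biUnion] at h
  adm_coarsen 𝒰 𝒱 h𝒰 h𝒱 hun href := by
    refine T.adm_coarsen h𝒰 ?_ ?_ ?_
    · rintro _ ⟨V, hV, rfl⟩; exact h𝒱 V hV
    · rw [sUnion_image_val, sUnion_image_val, hun]
    · rintro _ ⟨V, hV, rfl⟩
      obtain ⟨V', hV', hVV'⟩ := href V hV
      exact ⟨_, ⟨V', hV', rfl⟩, Set.image_mono hVV'⟩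
  isOpen_of_inter W 𝒰 h𝒰 hW hop := by
    refine T.isOpen_of_inter h𝒰 ?_ ?_
    · rw [sUnion_image_val]; exact Set.image_mono hW
    · rintro _ ⟨V, hV, rfl⟩
      rw [← Set.image_inter Subtype.val_injective]; exact hop V hV

/-- The canonical bijection from a subset `V` of the subspace `U`, seen in the whole space, to
`V`. -/
def ofImage {X : Type u} {U : Set X} (V : Set U) (x : (Subtype.val '' V : Set X)) : V :=
  ⟨⟨x.1, by obtain ⟨y, _, h⟩ := x.2; exact h ▸ y.2⟩, by
    obtain ⟨_, y, hy, rfl⟩ := x; exact hy⟩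

/-- An open subspace: the function sheaf is restricted to the open set. -/
def restrict (X : Space M) (U : Set X) (hU : X.top.IsOpen U) : Space M where
  carrier := U
  top := restrictTop X.top U hU
  sections V hV := {s | s ∘ ofImage V ∈ X.sections (Subtype.val '' V) hV}
  res_mem V W hV hW hWV s hs := X.res_mem hV hW (Set.image_mono hWV) _ hs
  glue_mem 𝒱 h𝒱 s hs := by
    have h𝒱' : X.top.Adm ((fun V : Set U => (Subtype.val '' V : Set X)) '' 𝒱) := h𝒱
    have he := sUnion_image_val 𝒱
    refine X.sections_congr he (X.top.isOpen_sUnion h𝒱') _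
      (s := fun x => s (ofImage _ ⟨x.1, he ▸ x.2⟩)) (fun _ _ _ => rfl) ?_
    refine X.glue_mem h𝒱' _ ?_
    rintro _ ⟨V, hV, rfl⟩
    exact hs V hV

end Space

/-! ### Definable sets as spaces -/

section Definable

variable (L : FirstOrder.Language.{v, w}) {M : Type u} [L.Structure M]

/-- Definability in the structure `M`, with parameters from `M`. -/
def IsDef {n : ℕ} (S : Set (Fin n → M)) : Prop :=
  (Set.univ : Set M).Definable L S

/-- The graph of a function on a subset of a subset of `M ^ n`, as a subset of `M ^ (n + 1)`. -/
def graph {n : ℕ} {D : Set (Fin n → M)} {V : Set D} (s : V → M) : Set (Fin (n + 1) → M) :=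
  {y | ∃ x : V, y = Fin.snoc (α := fun _ => M) x.1.1 (s x)}

theorem isDef_sUnion {n : ℕ} {D : Set (Fin n → M)} {𝒰 : Set (Set D)} (hfin : 𝒰.Finite)
    (h : ∀ U ∈ 𝒰, IsDef L (Subtype.val '' U)) : IsDef L (Subtype.val '' (⋃₀ 𝒰)) := by
  have := hfin.to_subtype
  rw [Set.sUnion_eq_iUnion, Set.image_iUnion]
  exact Set.definable_iUnion_of_finite fun U : 𝒰 => h U.1 U.2

theorem graph_inclusion {n : ℕ} {D : Set (Fin n → M)} {U V : Set D} (hVU : V ⊆ U) (s : U → M) :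
    graph (s ∘ Set.inclusion hVU) =
      graph s ∩ {y | (fun i => y (Fin.castSucc i)) ∈ (Subtype.val '' V : Set (Fin n → M))} := by
  ext y
  constructor
  · rintro ⟨x, rfl⟩
    refine ⟨⟨Set.inclusion hVU x, rfl⟩, x.1, x.2, ?_⟩
    funext i
    simp
  · rintro ⟨⟨x, rfl⟩, z, hz, hzx⟩
    have hxz : x.1 = z := by
      apply Subtype.ext
      rw [hzx]
      funext i
      simp
    exact ⟨⟨x.1, hxz ▸ hz⟩, rfl⟩

/-- The product `D × E ⊆ M ^ (n + m)` of `D ⊆ M ^ n` and `E ⊆ M ^ m`. -/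
def prodSet {n m : ℕ} (D : Set (Fin n → M)) (E : Set (Fin m → M)) : Set (Fin (n + m) → M) :=
  {y | (fun i => y (Fin.castAdd m i)) ∈ D ∧ (fun j => y (Fin.natAdd n j)) ∈ E}

variable {L} in
theorem isDef_prodSet {n m : ℕ} {D : Set (Fin n → M)} {E : Set (Fin m → M)} (hD : IsDef L D)
    (hE : IsDef L E) : IsDef L (prodSet D E) :=
  Set.Definable.inter (Set.Definable.preimage_comp (Fin.castAdd m) hD)
    (Set.Definable.preimage_comp (Fin.natAdd n) hE)

variable [TopologicalSpace M]

/-- The small generalized topology of a definable set `D ⊆ M ^ n`: the open sets are the relatively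
open definable subsets, the admissible families are the essentially finite open families. -/
def defTop {n : ℕ} (D : Set (Fin n → M)) (hD : IsDef L D) : GenTop D where
  IsOpen U := IsOpen U ∧ IsDef L (Subtype.val '' U)
  Adm 𝒰 := (∀ U ∈ 𝒰, IsOpen U ∧ IsDef L (Subtype.val '' U)) ∧
    ∃ 𝒰₀ ⊆ 𝒰, 𝒰₀.Finite ∧ ⋃₀ 𝒰₀ = ⋃₀ 𝒰
  isOpen_of_mem 𝒰 h𝒰 U hU := h𝒰.1 U hU
  isOpen_empty := ⟨isOpen_empty, by
    rw [Set.image_empty]; exact Set.definable_empty⟩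
  isOpen_univ := ⟨isOpen_univ, by simpa using hD⟩
  isOpen_union U V hU hV := ⟨hU.1.union hV.1, by
    rw [Set.image_union]; exact Set.Definable.union hU.2 hV.2⟩
  isOpen_inter U V hU hV := ⟨hU.1.inter hV.1, by
    rw [Set.image_inter Subtype.val_injective]; exact Set.Definable.inter hU.2 hV.2⟩
  adm_of_finite 𝒰 hfin hop := ⟨hop, 𝒰, subset_rfl, hfin, rfl⟩
  isOpen_sUnion := by
    rintro 𝒰 ⟨hop, 𝒰₀, hsub, hfin, hun⟩
    rw [← hun]
    exact ⟨isOpen_sUnion fun U hU => (hop U (hsub hU)).1,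
      isDef_sUnion L hfin fun U hU => (hop U (hsub hU)).2⟩
  adm_inter := by
    rintro V 𝒰 hV ⟨hop, 𝒰₀, hsub, hfin, hun⟩
    refine ⟨?_, _, Set.image_mono hsub, hfin.image _, ?_⟩
    · rintro _ ⟨U, hU, rfl⟩
      refine ⟨hV.1.inter (hop U hU).1, ?_⟩
      rw [Set.image_inter Subtype.val_injective]
      exact Set.Definable.inter hV.2 (hop U hU).2
    · rw [Set.sUnion_image, Set.sUnion_image, ← Set.inter_iUnion₂, ← Set.inter_iUnion₂,
        ← Set.sUnion_eq_biUnion, ← Set.sUnion_eq_biUnion, hun]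
  adm_trans := by
    rintro Φ hΦ ⟨-, 𝒲, hsub, hfin, hun⟩
    refine ⟨fun U ⟨𝒱, h𝒱, hU⟩ => (hΦ 𝒱 h𝒱).1 U hU, ?_⟩
    obtain ⟨Φ₀, hΦ₀, hΦfin, rfl⟩ := Set.exists_subset_image_finite_and.mp
      ⟨𝒲, hsub, hfin, rfl⟩
    choose! F hF using fun 𝒱 h𝒱 => (hΦ 𝒱 h𝒱).2
    refine ⟨⋃ 𝒱 ∈ Φ₀, F 𝒱, ?_, hΦfin.biUnion fun 𝒱 h𝒱 => (hF 𝒱 (hΦ₀ h𝒱)).2.1, ?_⟩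
    · refine Set.iUnion₂_subset fun 𝒱 h𝒱 U hU => ⟨𝒱, hΦ₀ h𝒱, (hF 𝒱 (hΦ₀ h𝒱)).1 hU⟩
    · apply Set.Subset.antisymm
      · rintro x ⟨U, hU, hx⟩
        obtain ⟨𝒱, h𝒱, hU⟩ := Set.mem_iUnion₂.mp hU
        exact ⟨U, ⟨𝒱, hΦ₀ h𝒱, (hF 𝒱 (hΦ₀ h𝒱)).1 hU⟩, hx⟩
      · rintro x ⟨U, ⟨𝒱, h𝒱, hU⟩, hx⟩
        have hx' : x ∈ ⋃₀ (Set.sUnion '' Φ) := ⟨_, ⟨𝒱, h𝒱, rfl⟩, ⟨U, hU, hx⟩⟩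
        rw [← hun] at hx'
        obtain ⟨_, ⟨𝒱', h𝒱', rfl⟩, hx'⟩ := hx'
        rw [← (hF 𝒱' (hΦ₀ h𝒱')).2.2] at hx'
        obtain ⟨U', hU', hx'⟩ := hx'
        exact ⟨U', Set.mem_iUnion₂.mpr ⟨𝒱', h𝒱', hU'⟩, hx'⟩
  adm_coarsen := by
    rintro 𝒰 𝒱 ⟨-, 𝒰₀, hsub, hfin, hun⟩ hop heq href
    choose! F hF using href
    refine ⟨hop, F '' 𝒰₀, ?_, hfin.image _, ?_⟩
    · rintro _ ⟨U, hU, rfl⟩; exact (hF U (hsub hU)).1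
    · apply Set.Subset.antisymm
      · rintro x ⟨_, ⟨U, hU, rfl⟩, hx⟩
        exact ⟨_, (hF U (hsub hU)).1, hx⟩
      · rw [← heq, ← hun]
        rintro x ⟨U, hU, hx⟩
        exact ⟨_, ⟨U, hU, rfl⟩, (hF U (hsub hU)).2 hx⟩
  isOpen_of_inter := by
    rintro W 𝒰 ⟨-, 𝒰₀, hsub, hfin, hun⟩ hW hop
    have hWeq : W = ⋃₀ ((fun U => W ∩ U) '' 𝒰₀) := by
      rw [Set.sUnion_image, ← Set.inter_iUnion₂, ← Set.sUnion_eq_biUnion, hun,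
        Set.inter_eq_left.mpr hW]
    rw [hWeq]
    constructor
    · refine isOpen_sUnion ?_
      rintro _ ⟨U, hU, rfl⟩
      exact (hop U (hsub hU)).1
    · refine isDef_sUnion L (hfin.image _) ?_
      rintro _ ⟨U, hU, rfl⟩
      exact (hop U (hsub hU)).2

/-- A definable set `D ⊆ M ^ n` with its usual structure of a space over `M`: the sections are the
continuous definable `M`-valued functions. -/
def defSpace {n : ℕ} (D : Set (Fin n → M)) (hD : IsDef L D) : Space M where
  carrier := D
  top := defTop L D hD
  sections V _ := {s | Continuous s ∧ IsDef L (graph s)}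
  res_mem U V hU hV hVU s hs := by
    refine ⟨hs.1.comp (continuous_inclusion hVU), ?_⟩
    rw [graph_inclusion]
    exact Set.Definable.inter hs.2 (Set.Definable.preimage_comp Fin.castSucc hV.2)
  glue_mem := by
    rintro 𝒰 ⟨hop, 𝒰₀, hsub, hfin, hun⟩ s hs
    constructor
    · rw [continuous_iff_continuousAt]
      rintro ⟨x, U, hU, hx⟩
      have hV : IsOpen (Subtype.val ⁻¹' U : Set ↥(⋃₀ 𝒰)) :=
        (hop U hU).1.preimage continuous_subtype_val
      refine ContinuousOn.continuousAt (s := Subtype.val ⁻¹' U) ?_ (hV.mem_nhds hx)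
      rw [continuousOn_iff_continuous_domRestrict]
      have hc : Continuous fun y : ↥(Subtype.val ⁻¹' U : Set ↥(⋃₀ 𝒰)) => (⟨y.1.1, y.2⟩ : U) :=
        Continuous.subtype_mk (continuous_subtype_val.comp continuous_subtype_val) _
      exact (hs U hU).1.comp hc
    · have := hfin.to_subtype
      have hg : graph s = ⋃ U : 𝒰₀,
          graph (s ∘ Set.inclusion (Set.subset_sUnion_of_mem (hsub U.2))) := by
        ext y
        rw [Set.mem_iUnion]
        constructor
        · rintro ⟨⟨x, hx⟩, rfl⟩
          have hx' := hx
          rw [← hun] at hx'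
          obtain ⟨U, hU, hxU⟩ := hx'
          exact ⟨⟨U, hU⟩, ⟨x, hxU⟩, rfl⟩
        · rintro ⟨U, x, rfl⟩
          exact ⟨_, rfl⟩
      rw [hg]
      exact Set.definable_iUnion_of_finite fun U : 𝒰₀ => (hs U.1 (hsub U.2)).2

/-! ### Locally definable spaces -/

/-- Affine definable spaces: those isomorphic to a definable subset of some `M ^ n`. -/
def IsAffine (X : Space M) : Prop :=
  ∃ (n : ℕ) (D : Set (Fin n → M)) (hD : IsDef L D), Nonempty (X ≅ defSpace L D hD)

/-- `𝒰` is an admissible covering of `X` by affine definable open subspaces. -/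
def IsAffineCovering (X : Space M) (𝒰 : Set (Set X)) : Prop :=
  X.top.Adm 𝒰 ∧ ⋃₀ 𝒰 = Set.univ ∧
    ∀ U ∈ 𝒰, ∃ hU : X.top.IsOpen U, IsAffine L (X.restrict U hU)

/-- Locally definable spaces over `M`. -/
def IsLocallyDefinable : ObjectProperty (Space M) :=
  fun X => ∃ 𝒰 : Set (Set X), IsAffineCovering L X 𝒰

variable (M) in
/-- The category of locally definable spaces over `M`, a full subcategory of the category of
spaces over `M`. -/
abbrev LDS := (IsLocallyDefinable L (M := M)).FullSubcategory

variable {L}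

/-- The underlying map of a morphism of locally definable spaces. -/
def LDS.map {X Y : LDS L M} (f : X ⟶ Y) : X.obj → Y.obj := f.hom.toFun

theorem LDS.isOpen_preimage {X Y : LDS L M} (f : X ⟶ Y) {V : Set Y.obj}
    (hV : Y.obj.top.IsOpen V) : X.obj.top.IsOpen (LDS.map f ⁻¹' V) :=
  f.hom.strict.isOpen_preimage hV

/-! ### Products -/

/-- The open subset `p₁⁻¹(U) ∩ p₂⁻¹(V)`, i.e. `U × V` when `P` is carried by `X × Y`. -/
def box {X Y P : LDS L M} (p₁ : P ⟶ X) (p₂ : P ⟶ Y) (U : Set X.obj) (V : Set Y.obj) :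
    Set P.obj :=
  LDS.map p₁ ⁻¹' U ∩ LDS.map p₂ ⁻¹' V

theorem isOpen_box {X Y P : LDS L M} (p₁ : P ⟶ X) (p₂ : P ⟶ Y) {U : Set X.obj} {V : Set Y.obj}
    (hU : X.obj.top.IsOpen U) (hV : Y.obj.top.IsOpen V) : P.obj.top.IsOpen (box p₁ p₂ U V) :=
  P.obj.top.isOpen_inter (LDS.isOpen_preimage p₁ hU) (LDS.isOpen_preimage p₂ hV)

/-- The open subspace `U × V` of `P` is the product of the affine definable spaces `U` and `V`:
whenever charts identify `U` and `V` with definable sets `D ⊆ M ^ n` and `E ⊆ M ^ m`, the product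
of the two charts identifies `U × V` with the definable set `D × E ⊆ M ^ (n + m)`. -/
def IsAffineProductOn {X Y P : LDS L M} (p₁ : P ⟶ X) (p₂ : P ⟶ Y) (U : Set X.obj)
    (V : Set Y.obj) : Prop :=
  ∀ (hU : X.obj.top.IsOpen U) (hV : Y.obj.top.IsOpen V)
    (n m : ℕ) (D : Set (Fin n → M)) (E : Set (Fin m → M)) (hD : IsDef L D) (hE : IsDef L E)
    (φ : X.obj.restrict U hU ≅ defSpace L D hD) (ψ : Y.obj.restrict V hV ≅ defSpace L E hE),
    ∃ e : P.obj.restrict (box p₁ p₂ U V) (isOpen_box p₁ p₂ hU hV) ≅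
        defSpace L (prodSet D E) (isDef_prodSet hD hE),
      ∀ z : box p₁ p₂ U V, (e.hom.toFun z).1 =
        Fin.append (φ.hom.toFun ⟨LDS.map p₁ z.1, z.2.1⟩).1 (ψ.hom.toFun ⟨LDS.map p₂ z.1, z.2.2⟩).1

/-- `(P, p₁, p₂)` is the admissible union of the products `U × V` (`U ∈ 𝒰`, `V ∈ 𝒱`) of affine
definable spaces, on the underlying set `X × Y` with its two projections. -/
structure IsAdmissibleUnionOfProducts {X Y P : LDS L M} (𝒰 : Set (Set X.obj)) (𝒱 : Set (Set Y.obj))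
    (p₁ : P ⟶ X) (p₂ : P ⟶ Y) : Prop where
  bijective : Function.Bijective fun z : P.obj => (LDS.map p₁ z, LDS.map p₂ z)
  adm : P.obj.top.Adm (Set.image2 (box p₁ p₂) 𝒰 𝒱)
  cover : ⋃₀ (Set.image2 (box p₁ p₂) 𝒰 𝒱) = Set.univ
  affine : ∀ U ∈ 𝒰, ∀ V ∈ 𝒱, IsAffineProductOn p₁ p₂ U V

/-! ### Locally definable subsets and subspaces -/

variable (L) in
/-- The image of a subset `S` of a space under a chart `φ : U ≅ D ⊆ M ^ n` of an open subspace. -/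
def chartImage {X : Space M} {U : Set X} {hU : X.top.IsOpen U} {n : ℕ} {D : Set (Fin n → M)}
    {hD : IsDef L D} (φ : X.restrict U hU ≅ defSpace L D hD) (S : Set X) : Set (Fin n → M) :=
  {y | ∃ x : U, x.1 ∈ S ∧ y = (φ.hom.toFun x).1}

/-- `S` is a locally definable subset of `X`: its trace on every affine definable open subspace is
definable. -/
def IsLocallyDefinableSet (X : LDS L M) (S : Set X.obj) : Prop :=
  ∀ (U : Set X.obj) (hU : X.obj.top.IsOpen U) (n : ℕ) (D : Set (Fin n → M)) (hD : IsDef L D)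
    (φ : X.obj.restrict U hU ≅ defSpace L D hD), IsDef L (chartImage L φ S)

/-- `i` identifies `W` with the subspace of `X` given by the locally definable subset `S`: it is
injective with image `S`, and for every affine definable open subspace `U` of `X` it identifies the
open subspace `i⁻¹(U)` of `W` with the affine definable space `S ∩ U`. -/
structure IsSubspace {W X : LDS L M} (i : W ⟶ X) (S : Set X.obj) : Prop where
  injective : Function.Injective (LDS.map i)
  range_eq : Set.range (LDS.map i) = S
  locallyDefinable : IsLocallyDefinableSet X S
  affine : ∀ (U : Set X.obj) (hU : X.obj.top.IsOpen U) (n : ℕ) (D : Set (Fin n → M))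
    (hD : IsDef L D) (φ : X.obj.restrict U hU ≅ defSpace L D hD),
    ∃ e : W.obj.restrict (LDS.map i ⁻¹' U) (LDS.isOpen_preimage i hU) ≅
        defSpace L (chartImage L φ S) (locallyDefinable U hU n D hD φ),
      ∀ x : ↥(LDS.map i ⁻¹' U), (e.hom.toFun x).1 = (φ.hom.toFun ⟨LDS.map i x.1, x.2⟩).1

/-- `P` with the projections `p₁`, `p₂` is a product of `X` and `Y` in the category of locally
definable spaces. -/
def IsProduct {X Y P : LDS L M} (p₁ : P ⟶ X) (p₂ : P ⟶ Y) : Prop :=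
  Nonempty (IsLimit (BinaryFan.mk p₁ p₂))

/-- The diagonal of `Z × Z`, for a product `Q` of `Z` with itself with projections `q₁`, `q₂`. -/
def diagonal {Z Q : LDS L M} (q₁ q₂ : Q ⟶ Z) : Set Q.obj :=
  {z | LDS.map q₁ z = LDS.map q₂ z}

end Definable

end LocDef

/-!
# Finite limits of locally definable spaces

Every locally definable space carries the final structure for all morphisms `T → X` from definable
sets `T ⊆ M ^ n`: admissibility, sections, and hence morphisms out of `X`, are tested after pulling
back along such maps (`IsGenerated`, `IsLocallyDefinable.isGenerated`). Between definable sets the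
morphisms are exactly the continuous definable maps (`IsDefMap.isMorphism`,
`Space.IsMorphism.continuous`, `Space.IsMorphism.isDefMap`), so that pairing of morphisms into
definable sets and shrinking of the target reduce to plain topology and definability.

No gluing of charts is needed. The product of `X` and `Y` is the set `X × Y` with the final
structure for all maps `T → X × Y` whose two components are morphisms (`productSpace`), and the
subspace on `S ⊆ X` is `S` with the final structure for all maps `T → S` which are morphisms into
`X` (`subSpace`). The universal property then holds by definition for maps from definable sets,
and for all locally definable spaces because these are generated by definable sets.

The same two universal properties, `IsProductMap` and `IsSubspaceMap`, imply the description by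
charts: given charts `U ≅ D` and `V ≅ E`, the map `U × V → D × E` is a morphism since the target is
a definable set and its components are morphisms, and its inverse is a morphism since its source is
a definable set and its components are morphisms (`IsProductMap.exists_chart`,
`IsSubspaceMap.exists_chart`). This proves local definability of the constructed spaces and, applied
to an arbitrary product or fiber product, one direction of the two characterizations. Conversely,
the description by charts gives the universal property by checking locally on an admissible covering
(`isMorphism_of_product_chart`, `isMorphism_of_subspace_chart`). That categorical products and fiber
products have the expected underlying sets follows since every map from the point `M ^ 0` is a
morphism (`isMorphism_of_point`).

The subspaces that occur are given by the sets on which two morphisms `a, b : X ⟶ Z` agree. These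
are locally definable (`isDef_eqLocus`): on a chart, the preimages under `a` of finitely many affine
open subspaces `W` of `Z` suffice, and the set where `a` and `b` agree with value in `W` is the set
where two definable maps agree. The diagonal and its preimage under `f × g` are both of this form.
-/

namespace LocDef

/-! ### Admissible families and coverings -/

namespace GenTop

variable {X : Type u} (T : GenTop X)

/-- The pairwise intersections of two admissible families form an admissible family. -/
theorem adm_image2_inter {𝒰 𝒱 : Set (Set X)} (h𝒰 : T.Adm 𝒰) (h𝒱 : T.Adm 𝒱) :
    T.Adm (Set.image2 (· ∩ ·) 𝒰 𝒱) := by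
  have h := T.adm_trans (Φ := (fun U => (fun V => U ∩ V) '' 𝒱) '' 𝒰) ?_ ?_
  · rwa [Set.sUnion_image, Set.iUnion_image_left] at h
  · rintro _ ⟨U, hU, rfl⟩
    exact T.adm_inter (T.isOpen_of_mem h𝒰 hU) h𝒱
  · have h := T.adm_inter (T.isOpen_sUnion h𝒱) h𝒰
    rw [Set.image_image]
    convert h using 2
    rw [Set.sUnion_image, ← Set.inter_iUnion₂, ← Set.sUnion_eq_biUnion, Set.inter_comm]

/-- Openness is local on an admissible covering. -/
theorem isOpen_of_covering {𝒰 : Set (Set X)} (h𝒰 : T.Adm 𝒰) (hcov : ⋃₀ 𝒰 = Set.univ) {W : Set X}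
    (h : ∀ U ∈ 𝒰, T.IsOpen (U ∩ W)) : T.IsOpen W :=
  T.isOpen_of_inter h𝒰 ((Set.subset_univ W).trans hcov.ge) fun U hU => by
    rw [Set.inter_comm]; exact h U hU

/-- Admissibility is local on an admissible covering. -/
theorem adm_of_covering {𝒰 : Set (Set X)} (h𝒰 : T.Adm 𝒰) (hcov : ⋃₀ 𝒰 = Set.univ)
    {𝒲 : Set (Set X)} (h : ∀ U ∈ 𝒰, T.Adm ((fun W => U ∩ W) '' 𝒲)) : T.Adm 𝒲 := by
  have hun (U : Set X) : ⋃₀ ((fun W => U ∩ W) '' 𝒲) = U ∩ ⋃₀ 𝒲 := by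
    rw [Set.sUnion_image, ← Set.inter_iUnion₂, ← Set.sUnion_eq_biUnion]
  have hW : ∀ W ∈ 𝒲, T.IsOpen W := fun W hW =>
    T.isOpen_of_covering h𝒰 hcov fun U hU => T.isOpen_of_mem (h U hU) ⟨W, hW, rfl⟩
  have hop : T.IsOpen (⋃₀ 𝒲) := T.isOpen_of_covering h𝒰 hcov fun U hU =>
    hun U ▸ T.isOpen_sUnion (h U hU)
  -- The traces of `𝒲` on the members of `𝒰` together form an admissible refinement of `𝒲`.
  have htr := T.adm_trans (Φ := (fun U => (fun W => U ∩ W) '' 𝒲) '' 𝒰) ?_ ?_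
  · refine T.adm_coarsen htr hW ?_ ?_
    · rw [Set.sUnion_image, Set.iUnion_image_left]
      apply Set.Subset.antisymm
      · rintro x ⟨_, ⟨U, -, W, hW, rfl⟩, -, hx⟩
        exact ⟨W, hW, hx⟩
      · rintro x ⟨W, hW, hx⟩
        obtain ⟨U, hU, hxU⟩ := hcov.ge (Set.mem_univ x)
        exact ⟨_, ⟨U, hU, W, hW, rfl⟩, hxU, hx⟩
    · rintro _ ⟨_, ⟨U, -, rfl⟩, W, hW, rfl⟩
      exact ⟨W, hW, Set.inter_subset_right⟩
  · rintro _ ⟨U, hU, rfl⟩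
    exact h U hU
  · have h' := T.adm_inter hop h𝒰
    rw [Set.image_image]
    convert h' using 2
    rw [hun, Set.inter_comm]

end GenTop

namespace Space

variable {M : Type u}

/-- Being a section is local on an admissible covering. -/
theorem mem_sections_of_covering (X : Space M) {𝒰 : Set (Set X)} (h𝒰 : X.top.Adm 𝒰)
    (hcov : ⋃₀ 𝒰 = Set.univ) {W : Set X} (hW : X.top.IsOpen W) {s : W → M}
    (h : ∀ (U : Set X) (hU : U ∈ 𝒰), s ∘ Set.inclusion Set.inter_subset_left ∈
      X.sections (W ∩ U) (X.top.isOpen_inter hW (X.top.isOpen_of_mem h𝒰 hU))) :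
    s ∈ X.sections W hW := by
  have hadm := X.top.adm_inter hW h𝒰
  have he : ⋃₀ ((fun U => W ∩ U) '' 𝒰) = W := by
    rw [Set.sUnion_image, ← Set.inter_iUnion₂, ← Set.sUnion_eq_biUnion, hcov, Set.inter_univ]
  refine X.sections_congr he (X.top.isOpen_sUnion hadm) hW (s := fun x => s ⟨x.1, he.le x.2⟩)
    (fun _ _ _ => rfl) (X.glue_mem hadm _ ?_)
  rintro _ ⟨U, hU, rfl⟩
  exact h U hU

/-! ### Morphisms as a property of maps -/

/-- The property of a map of being the underlying map of a morphism of spaces. -/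
structure IsMorphism {X Y : Space M} (f : X → Y) : Prop where
  strict : StrictlyContinuous f
  comp_mem : ∀ (V : Set Y) (hV : Y.top.IsOpen V), ∀ s ∈ Y.sections V hV,
    s ∘ V.restrictPreimage f ∈ X.sections (f ⁻¹' V) (strict.isOpen_preimage hV)

theorem isMorphism_toFun {X Y : Space M} (f : X ⟶ Y) : IsMorphism f.toFun :=
  ⟨f.strict, f.comp_mem⟩

namespace IsMorphism

variable {X Y Z : Space M}

/-- The morphism with a given underlying map. -/
def hom {f : X → Y} (hf : IsMorphism f) : X ⟶ Y :=
  (⟨f, hf.strict, hf.comp_mem⟩ : Hom X Y)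

theorem comp {g : Y → Z} {f : X → Y} (hg : IsMorphism g) (hf : IsMorphism f) :
    IsMorphism fun x => g (f x) :=
  isMorphism_toFun (hf.hom ≫ hg.hom)

/-- An isomorphism of spaces from two mutually inverse maps which are morphisms. -/
def iso {f : X → Y} {g : Y → X} (hf : IsMorphism f) (hg : IsMorphism g)
    (hgf : ∀ x, g (f x) = x) (hfg : ∀ y, f (g y) = y) : X ≅ Y where
  hom := hf.hom
  inv := hg.hom
  hom_inv_id := Hom.ext (funext hgf)
  inv_hom_id := Hom.ext (funext hfg)

end IsMorphism

theorem iso_inv_hom {X Y : Space M} (e : X ≅ Y) (y : Y) : e.hom.toFun (e.inv.toFun y) = y :=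
  congrFun (congrArg Hom.toFun e.inv_hom_id) y

theorem iso_hom_inv {X Y : Space M} (e : X ≅ Y) (x : X) : e.inv.toFun (e.hom.toFun x) = x :=
  congrFun (congrArg Hom.toFun e.hom_inv_id) x

theorem isMorphism_id (X : Space M) : IsMorphism (fun x : X => x) :=
  isMorphism_toFun (𝟙 X)

theorem isMorphism_val (X : Space M) {U : Set X} (hU : X.top.IsOpen U) :
    IsMorphism (X := X.restrict U hU) (Y := X) Subtype.val where
  strict 𝒱 h𝒱 := by
    have he : (fun V : Set U => (Subtype.val '' V : Set X)) ''
        ((fun V : Set X => (Subtype.val ⁻¹' V : Set U)) '' 𝒱) = (fun V => U ∩ V) '' 𝒱 := by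
      simp only [Set.image_image, Subtype.image_preimage_coe]
    exact Eq.mpr (congrArg X.top.Adm he) (X.top.adm_inter hU h𝒱)
  comp_mem V hV s hs :=
    X.res_mem hV _ (Set.image_preimage_subset Subtype.val V) s hs

/-- A map into an open subspace is a morphism as soon as it is one into the whole space. -/
theorem IsMorphism.of_val {T X : Space M} {U : Set X} {hU : X.top.IsOpen U}
    {f : T → X.restrict U hU} (hf : IsMorphism (Y := X) fun t => (f t).1) : IsMorphism f := by
  have hpre (V : Set U) : (fun t => (f t).1) ⁻¹' (Subtype.val '' V) = f ⁻¹' V := by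
    ext t
    simp only [Set.mem_preimage]
    exact Subtype.val_injective.mem_set_image
  have hs : StrictlyContinuous f := fun 𝒱 h𝒱 => by
    have he : (fun V => (fun t => (f t).1) ⁻¹' V) ''
        ((fun V : Set U => (Subtype.val '' V : Set X)) '' 𝒱) = (fun V => f ⁻¹' V) '' 𝒱 :=
      (Set.image_image _ _ _).trans (Set.image_congr fun V _ => hpre V)
    exact Eq.mp (congrArg T.top.Adm he) (hf.strict _ h𝒱)
  exact ⟨hs, fun V hV s hs' => T.sections_congr (hpre V)
    (hf.strict.isOpen_preimage (V := Subtype.val '' V) hV) _ (fun _ _ _ => rfl)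
    (hf.comp_mem (Subtype.val '' V) hV _ hs')⟩

theorem IsMorphism.comp_codRestrict {T X Y : Space M} {U : Set X} {hU : X.top.IsOpen U}
    {g : U → Y} (hg : IsMorphism (X := X.restrict U hU) g) {f : T → X} (hf : IsMorphism f)
    (h : ∀ x, f x ∈ U) : IsMorphism fun x => g ⟨f x, h x⟩ :=
  hg.comp (Y := X.restrict U hU) (f := fun x => ⟨f x, h x⟩) (IsMorphism.of_val hf)

/-- Being a morphism is local on an admissible covering of the source. -/
theorem isMorphism_of_covering {X Y : Space M} {f : X → Y} {𝒰 : Set (Set X)} (h𝒰 : X.top.Adm 𝒰)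
    (hcov : ⋃₀ 𝒰 = Set.univ)
    (h : ∀ (U : Set X) (hU : U ∈ 𝒰),
      IsMorphism (X := X.restrict U (X.top.isOpen_of_mem h𝒰 hU)) (Y := Y) fun x => f x.1) :
    IsMorphism f := by
  have hval (U : Set X) (V : Set Y) :
      (Subtype.val '' ((fun x : U => f x.1) ⁻¹' V) : Set X) = U ∩ f ⁻¹' V :=
    Subtype.image_preimage_coe U (f ⁻¹' V)
  have hstr : StrictlyContinuous f := by
    intro 𝒱 h𝒱
    refine X.top.adm_of_covering h𝒰 hcov fun U hU => ?_
    have he : (fun V : Set U => (Subtype.val '' V : Set X)) ''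
        ((fun V : Set Y => (fun x : U => f x.1) ⁻¹' V) '' 𝒱) =
          (fun W => U ∩ W) '' ((fun V => f ⁻¹' V) '' 𝒱) := by
      simp only [Set.image_image, hval]
    exact Eq.mp (congrArg X.top.Adm he) ((h U hU).strict 𝒱 h𝒱)
  refine ⟨hstr, fun V hV s hs => X.mem_sections_of_covering h𝒰 hcov _ fun U hU => ?_⟩
  exact X.sections_congr ((hval U V).trans (Set.inter_comm _ _))
    ((h U hU).strict.isOpen_preimage hV) _ (fun _ _ _ => rfl) ((h U hU).comp_mem V hV s hs)

/-- Preimages of two admissible coverings intersect to an admissible covering. -/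
theorem adm_image2_preimage {X Y P : Space M} {p₁ : P → X} {p₂ : P → Y} (h₁ : IsMorphism p₁)
    (h₂ : IsMorphism p₂) {𝒰 : Set (Set X)} {𝒱 : Set (Set Y)} (h𝒰 : X.top.Adm 𝒰)
    (h𝒱 : Y.top.Adm 𝒱) : P.top.Adm (Set.image2 (fun U V => p₁ ⁻¹' U ∩ p₂ ⁻¹' V) 𝒰 𝒱) := by
  have h := P.top.adm_image2_inter (h₁.strict _ h𝒰) (h₂.strict _ h𝒱)
  rwa [Set.image2_image_left, Set.image2_image_right] at h

theorem sUnion_image_preimage {X P : Type*} {p : P → X} {𝒰 : Set (Set X)}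
    (h𝒰 : ⋃₀ 𝒰 = Set.univ) : ⋃₀ ((fun U => p ⁻¹' U) '' 𝒰) = Set.univ := by
  rw [Set.sUnion_image, ← Set.preimage_iUnion₂, ← Set.sUnion_eq_biUnion, h𝒰, Set.preimage_univ]

theorem sUnion_image2_preimage {X Y P : Type*} {p₁ : P → X} {p₂ : P → Y} {𝒰 : Set (Set X)}
    {𝒱 : Set (Set Y)} (h𝒰 : ⋃₀ 𝒰 = Set.univ) (h𝒱 : ⋃₀ 𝒱 = Set.univ) :
    ⋃₀ (Set.image2 (fun U V => p₁ ⁻¹' U ∩ p₂ ⁻¹' V) 𝒰 𝒱) = Set.univ := by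
  refine Set.eq_univ_of_forall fun z => ?_
  obtain ⟨U, hU, hxU⟩ := h𝒰.ge (Set.mem_univ (p₁ z))
  obtain ⟨V, hV, hyV⟩ := h𝒱.ge (Set.mem_univ (p₂ z))
  exact ⟨_, ⟨U, hU, V, hV, rfl⟩, hxU, hyV⟩

/-! ### Final structures -/

/-- The final structure of a space on a set `C` for a family of maps `t i : A i → C`: openness,
admissibility and sections are tested after pulling back along all the maps `t i`. -/
def finalSpace {ι : Type u} (A : ι → Space M) (C : Type u) (t : ∀ i, A i → C) : Space M where
  carrier := C
  top :=
    { IsOpen W := ∀ i, (A i).top.IsOpen (t i ⁻¹' W)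
      Adm 𝒲 := ∀ i, (A i).top.Adm ((fun W => t i ⁻¹' W) '' 𝒲)
      isOpen_of_mem 𝒲 h𝒲 W hW i := (A i).top.isOpen_of_mem (h𝒲 i) ⟨W, hW, rfl⟩
      isOpen_empty i := (A i).top.isOpen_empty
      isOpen_univ i := (A i).top.isOpen_univ
      isOpen_union V W hV hW i := (A i).top.isOpen_union (hV i) (hW i)
      isOpen_inter V W hV hW i := (A i).top.isOpen_inter (hV i) (hW i)
      adm_of_finite 𝒲 hfin hop i := (A i).top.adm_of_finite (hfin.image _) (by
        rintro _ ⟨W, hW, rfl⟩; exact hop W hW i)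
      isOpen_sUnion 𝒲 h𝒲 i := by
        have h := (A i).top.isOpen_sUnion (h𝒲 i)
        rwa [Set.sUnion_image, ← Set.preimage_iUnion₂, ← Set.sUnion_eq_biUnion] at h
      adm_inter V 𝒲 hV h𝒲 i := by
        have h := (A i).top.adm_inter (hV i) (h𝒲 i)
        rw [Set.image_image] at h ⊢
        exact h
      adm_trans Φ hΦ hΦ' i := by
        have h := (A i).top.adm_trans (Φ := (fun 𝒲 => (fun W => t i ⁻¹' W) '' 𝒲) '' Φ)
          (by rintro _ ⟨𝒲, h𝒲, rfl⟩; exact hΦ 𝒲 h𝒲 i)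
          (by
            have h' := hΦ' i
            rw [Set.image_image] at h' ⊢
            simpa only [Set.sUnion_image, Set.preimage_sUnion] using h')
        rwa [Set.sUnion_image, ← Set.image_iUnion₂, ← Set.sUnion_eq_biUnion] at h
      adm_coarsen 𝒰 𝒱 h𝒰 h𝒱 hun href i := by
        refine (A i).top.adm_coarsen (h𝒰 i) ?_ ?_ ?_
        · rintro _ ⟨V, hV, rfl⟩; exact h𝒱 V hV i
        · rw [Set.sUnion_image, Set.sUnion_image, ← Set.preimage_iUnion₂, ← Set.preimage_iUnion₂,
            ← Set.sUnion_eq_biUnion, ← Set.sUnion_eq_biUnion, hun]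
        · rintro _ ⟨V, hV, rfl⟩
          obtain ⟨V', hV', hVV'⟩ := href V hV
          exact ⟨_, ⟨V', hV', rfl⟩, Set.preimage_mono hVV'⟩
      isOpen_of_inter W 𝒰 h𝒰 hW hop i := by
        refine (A i).top.isOpen_of_inter (h𝒰 i) ?_ ?_
        · rw [Set.sUnion_image, ← Set.preimage_iUnion₂, ← Set.sUnion_eq_biUnion]
          exact Set.preimage_mono hW
        · rintro _ ⟨V, hV, rfl⟩
          exact hop V hV i }
  sections W hW := {s | ∀ i, s ∘ W.restrictPreimage (t i) ∈ (A i).sections (t i ⁻¹' W) (hW i)}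
  res_mem V W hV hW hWV s hs i := (A i).res_mem (hV i) (hW i) (Set.preimage_mono hWV) _ (hs i)
  glue_mem 𝒲 h𝒲 s hs i := by
    have he : ⋃₀ ((fun W => t i ⁻¹' W) '' 𝒲) = t i ⁻¹' ⋃₀ 𝒲 := by
      rw [Set.sUnion_image, ← Set.preimage_iUnion₂, ← Set.sUnion_eq_biUnion]
    refine (A i).sections_congr he ((A i).top.isOpen_sUnion (h𝒲 i)) _
      (s := fun x => s ⟨t i x.1, (he ▸ x.2 : x.1 ∈ t i ⁻¹' ⋃₀ 𝒲)⟩) (fun _ _ _ => rfl) ?_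
    refine (A i).glue_mem (h𝒲 i) _ ?_
    rintro _ ⟨W, hW, rfl⟩
    exact hs W hW i

variable {ι : Type u} (A : ι → Space M) {C : Type u} (t : ∀ i, A i → C)

theorem isMorphism_finalSpace_mk (i : ι) :
    IsMorphism (X := A i) (Y := finalSpace A C t) (t i) where
  strict _ h𝒱 := h𝒱 i
  comp_mem _ _ _ hs := hs i

theorem isMorphism_of_finalSpace {Y : Space M} {f : C → Y}
    (h : ∀ i, IsMorphism fun x => f (t i x)) : IsMorphism (X := finalSpace A C t) f where
  strict 𝒱 h𝒱 i :=
    Eq.mpr (congrArg (A i).top.Adm (Set.image_image _ _ _)) ((h i).strict 𝒱 h𝒱)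
  comp_mem V hV s hs i := (h i).comp_mem V hV s hs

end Space

end LocDef

namespace LocDef

open Space

/-! ### Definable maps -/

section Definable

variable {L : FirstOrder.Language.{v, w}} {M : Type u} [L.Structure M]

/-- The graph of a map `T → D` between subsets of `M ^ n` and `M ^ m`. Its points are indexed by
`Fin n ⊕ Fin m`, so that projections to either factor are reindexings along `Sum.inl`, `Sum.inr`. -/
def homGraph {n m : ℕ} {T : Set (Fin n → M)} {D : Set (Fin m → M)} (h : T → D) :
    Set (Fin n ⊕ Fin m → M) :=
  {y | ∃ x : T, y ∘ Sum.inl = x.1 ∧ y ∘ Sum.inr = (h x).1}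

variable (L) in
/-- A map between subsets of powers of `M` is definable if its graph is. -/
def IsDefMap {n m : ℕ} {T : Set (Fin n → M)} {D : Set (Fin m → M)} (h : T → D) : Prop :=
  (Set.univ : Set M).Definable L (homGraph h)

theorem definable_setOf_eq {α : Type*} (i j : α) :
    (Set.univ : Set M).Definable L {y : α → M | y i = y j} :=
  ⟨(FirstOrder.Language.Term.var i).equal (FirstOrder.Language.Term.var j), by
    ext y; simp⟩

theorem isDef_singleton {n : ℕ} (a : Fin n → M) : IsDef L {a} := by
  have := Set.definable_iInter_of_finite fun i : Fin n =>
    Set.Definable.preimage_comp (fun _ : Fin 1 => i)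
      ((Set.definable_iff_exists_formula_sum (A := Set.univ) (L := L)
        (s := {y : Fin 1 → M | y 0 = a i})).mpr
        ⟨(FirstOrder.Language.Term.var (Sum.inr 0)).equal
          (FirstOrder.Language.Term.var (Sum.inl ⟨a i, trivial⟩)), by ext y; simp⟩)
  refine (congrArg (IsDef L) ?_).mp this
  ext y
  rw [Set.mem_iInter]
  exact ⟨fun h => funext h, fun h i => congrFun h i⟩

section Maps

variable {n m k : ℕ} {T : Set (Fin n → M)} {D : Set (Fin m → M)} {E : Set (Fin k → M)}

/-- The preimage of a definable set under a definable map is definable. -/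
theorem IsDefMap.isDef_preimage {h : T → D} (hh : IsDefMap L h) {V : Set D}
    (hV : IsDef L (Subtype.val '' V)) : IsDef L (Subtype.val '' (h ⁻¹' V)) := by
  have := Set.Definable.image_comp (hh.inter (Set.Definable.preimage_comp Sum.inr hV)) Sum.inl
  refine (congrArg (IsDef L) ?_).mp this
  ext x
  constructor
  · rintro ⟨y, ⟨⟨t, hl, hr⟩, d, hd, hdy⟩, rfl⟩
    refine ⟨t, ?_, hl.symm⟩
    have : d = h t := Subtype.ext (hdy.trans hr)
    exact show h t ∈ V from this ▸ hd
  · rintro ⟨t, ht, rfl⟩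
    exact ⟨Sum.elim t.1 (h t).1, ⟨⟨t, rfl, rfl⟩, h t, ht, rfl⟩, rfl⟩

/-- The set on which two definable maps agree is definable. -/
theorem IsDefMap.isDef_eq {g h : T → D} (hg : IsDefMap L g) (hh : IsDefMap L h) :
    IsDef L (Subtype.val '' {x : T | g x = h x}) := by
  have := Set.Definable.image_comp (hg.inter hh) Sum.inl
  refine (congrArg (IsDef L) ?_).mp this
  ext x
  constructor
  · rintro ⟨y, ⟨⟨t, hl, hr⟩, t', hl', hr'⟩, rfl⟩
    have : t = t' := Subtype.ext (hl.symm.trans hl')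
    subst this
    exact ⟨t, Subtype.ext (hr.symm.trans hr'), hl.symm⟩
  · rintro ⟨t, ht, rfl⟩
    have ht : g t = h t := ht
    exact ⟨Sum.elim t.1 (h t).1, ⟨⟨t, rfl, ht ▸ rfl⟩, t, rfl, rfl⟩, rfl⟩

/-- A map that selects coordinates (with repetitions) is definable. -/
theorem isDefMap_of_reindex (hT : IsDef L T) {h : T → D} (c : Fin m → Fin n)
    (hc : ∀ x j, (h x).1 j = x.1 (c j)) : IsDefMap L h := by
  have := (Set.Definable.preimage_comp (Sum.inl : _ → Fin n ⊕ Fin m) hT).inter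
    (Set.definable_iInter_of_finite fun j : Fin m =>
      definable_setOf_eq (L := L) (M := M) (Sum.inr j : Fin n ⊕ Fin m) (Sum.inl (c j)))
  refine (congrArg ((Set.univ : Set M).Definable L) ?_).mp this
  ext y
  constructor
  · rintro ⟨hy, hc'⟩
    refine ⟨⟨_, hy⟩, rfl, funext fun j => ?_⟩
    rw [hc]
    exact Set.mem_iInter.mp hc' j
  · rintro ⟨x, hl, hr⟩
    refine ⟨?_, Set.mem_iInter.mpr fun j => ?_⟩
    · change y ∘ Sum.inl ∈ T
      rw [hl]; exact x.2
    · change (y ∘ Sum.inr) j = (y ∘ Sum.inl) (c j)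
      rw [hr, hl, hc]

/-- A map is definable if the graphs of its coordinate functions are. -/
theorem isDefMap_of_coord (hT : IsDef L T) {h : T → D}
    (hc : ∀ j : Fin m, IsDef L {y : Fin (n + 1) → M |
      ∃ x : T, y = Fin.snoc (α := fun _ => M) x.1 ((h x).1 j)}) : IsDefMap L h := by
  have := (Set.Definable.preimage_comp (Sum.inl : _ → Fin n ⊕ Fin m) hT).inter
    (Set.definable_iInter_of_finite fun j : Fin m => Set.Definable.preimage_comp
      (Fin.snoc (α := fun _ => Fin n ⊕ Fin m) Sum.inl (Sum.inr j)) (hc j))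
  refine (congrArg ((Set.univ : Set M).Definable L) ?_).mp this
  ext y
  have key (j : Fin m) (x : T) : y ∘ (Fin.snoc (α := fun _ => Fin n ⊕ Fin m) Sum.inl (Sum.inr j)) =
      Fin.snoc (α := fun _ => M) x.1 ((h x).1 j) ↔
      y ∘ Sum.inl = x.1 ∧ y (Sum.inr j) = (h x).1 j := by
    rw [Fin.comp_snoc]
    exact Fin.snoc_inj
  constructor
  · rintro ⟨hy, hc'⟩
    refine ⟨⟨_, hy⟩, rfl, funext fun j => ?_⟩
    obtain ⟨x, hx⟩ := Set.mem_iInter.mp hc' j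
    obtain ⟨hl, hr⟩ := (key j x).mp hx
    have : (⟨_, hy⟩ : T) = x := Subtype.ext hl
    rw [this]
    exact hr
  · rintro ⟨x, hl, hr⟩
    refine ⟨?_, Set.mem_iInter.mpr fun j => ⟨x, (key j x).mpr ⟨hl, congrFun hr j⟩⟩⟩
    change y ∘ Sum.inl ∈ T
    rw [hl]; exact x.2

theorem IsDefMap.congr_codomain {D' : Set (Fin m → M)} {h : T → D} (hh : IsDefMap L h)
    {h' : T → D'} (he : ∀ x, (h' x).1 = (h x).1) : IsDefMap L h' := by
  have : homGraph h' = homGraph h := by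
    ext y
    refine exists_congr fun x => and_congr_right fun _ => ?_
    rw [he]
  rwa [IsDefMap, this]

theorem append_mem_prodSet (d : D) (e : E) :
    Fin.append d.1 e.1 ∈ prodSet D E := by
  constructor
  · simpa only [Fin.append_left] using d.2
  · simpa only [Fin.append_right] using e.2

/-- The pairing of two definable maps is definable. -/
theorem IsDefMap.pair {a : T → D} {b : T → E} (ha : IsDefMap L a) (hb : IsDefMap L b)
    {h : T → prodSet D E} (hh : ∀ x, (h x).1 = Fin.append (a x).1 (b x).1) : IsDefMap L h := by
  have := (Set.Definable.preimage_comp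
      (Sum.map id (Fin.castAdd k) : Fin n ⊕ Fin m → Fin n ⊕ Fin (m + k)) ha).inter
    (Set.Definable.preimage_comp
      (Sum.map id (Fin.natAdd m) : Fin n ⊕ Fin k → Fin n ⊕ Fin (m + k)) hb)
  refine (congrArg ((Set.univ : Set M).Definable L) ?_).mp this
  ext y
  constructor
  · rintro ⟨⟨t, hl, hr⟩, t', hl', hr'⟩
    have : t = t' := Subtype.ext (hl.symm.trans hl')
    subst this
    refine ⟨t, hl, ?_⟩
    rw [hh, ← hr, ← hr']
    exact (Fin.append_castAdd_natAdd (f := y ∘ Sum.inr)).symm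
  · rintro ⟨t, hl, hr⟩
    rw [hh] at hr
    refine ⟨⟨t, hl, funext fun j => ?_⟩, t, hl, funext fun j => ?_⟩
    · exact (congrFun hr (Fin.castAdd k j)).trans (Fin.append_left _ _ j)
    · exact (congrFun hr (Fin.natAdd m j)).trans (Fin.append_right _ _ j)

/-- The graph of a definable function pulled back along a definable map is definable. -/
theorem IsDefMap.isDef_graph {h : T → D} (hh : IsDefMap L h) {V : Set D} {s : V → M}
    (hs : IsDef L (graph s)) : IsDef L (graph (s ∘ V.restrictPreimage h)) := by
  have := Set.Definable.image_comp ((Set.Definable.preimage_comp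
      (Sum.map Fin.castSucc id : Fin n ⊕ Fin m → Fin (n + 1) ⊕ Fin m) hh).inter
    (Set.Definable.preimage_comp (Fin.snoc (α := fun _ => Fin (n + 1) ⊕ Fin m) Sum.inr
      (Sum.inl (Fin.last n))) hs)) (Sum.inl : Fin (n + 1) → _)
  refine (congrArg (IsDef L) ?_).mp this
  ext y
  constructor
  · rintro ⟨z, ⟨⟨t, hl, hr⟩, d, hd⟩, rfl⟩
    change z ∘ _ = _ at hd
    rw [Fin.comp_snoc, Fin.snoc_inj] at hd
    have htd : h t = d.1 := Subtype.ext (hr.symm.trans hd.1)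
    refine ⟨⟨t, show h t ∈ V from htd ▸ d.2⟩, ?_⟩
    have hsd : s (V.restrictPreimage h ⟨t, show h t ∈ V from htd ▸ d.2⟩) = s d :=
      congrArg s (Subtype.ext htd)
    rw [Function.comp_apply, hsd, ← hd.2, ← hl]
    exact (Fin.snoc_init_self (z ∘ Sum.inl)).symm
  · rintro ⟨x, rfl⟩
    refine ⟨Sum.elim (Fin.snoc (α := fun _ => M) x.1.1 (s (V.restrictPreimage h x))) (h x.1).1,
      ⟨⟨x.1, ?_, rfl⟩, V.restrictPreimage h x, ?_⟩, rfl⟩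
    · funext j
      simp
    · change _ ∘ _ = _
      rw [Fin.comp_snoc, Fin.snoc_inj]
      exact ⟨rfl, by simp⟩

end Maps

end Definable

end LocDef

namespace LocDef

open Space

section Definable

variable {L : FirstOrder.Language.{v, w}} {M : Type u} [L.Structure M] [TopologicalSpace M]

/-! ### Morphisms between definable sets -/

section DefSpace

variable {n m k : ℕ} {T : Set (Fin n → M)} {D D' : Set (Fin m → M)} {E : Set (Fin k → M)}
  {hT : IsDef L T} {hD : IsDef L D} {hD' : IsDef L D'} {hE : IsDef L E}

/-- Continuous definable maps are morphisms. -/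
theorem IsDefMap.isMorphism {h : T → D} (hd : IsDefMap L h) (hc : Continuous h) :
    IsMorphism (X := defSpace L T hT) (Y := defSpace L D hD) h where
  strict := by
    rintro 𝒱 ⟨hop, 𝒱₀, hsub, hfin, hun⟩
    refine ⟨?_, _, Set.image_mono hsub, hfin.image _, ?_⟩
    · rintro _ ⟨V, hV, rfl⟩
      exact ⟨(hop V hV).1.preimage hc, hd.isDef_preimage (hop V hV).2⟩
    · have hpre (𝒲 : Set (Set D)) : ⋃₀ ((fun V => h ⁻¹' V) '' 𝒲) = h ⁻¹' ⋃₀ 𝒲 := by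
        rw [Set.sUnion_image, Set.preimage_sUnion]
      exact (hpre _).trans ((congrArg (fun V => h ⁻¹' V) hun).trans (hpre _).symm)
  comp_mem (V : Set D) hV (s : V → M) (hs : Continuous s ∧ IsDef L (graph s)) :=
    ⟨hs.1.comp (hc.restrictPreimage (s := V)), hd.isDef_graph hs.2⟩

theorem Space.IsMorphism.isSection_coord {h : T → D}
    (hh : IsMorphism (X := defSpace L T hT) (Y := defSpace L D hD) h) (j : Fin m) :
    Continuous (fun x : (Set.univ : Set T) => (h x.1).1 j) ∧
      IsDef L (graph fun x : (Set.univ : Set T) => (h x.1).1 j) := by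
  refine hh.comp_mem Set.univ (defSpace L D hD).top.isOpen_univ (fun x => x.1.1 j) ⟨?_, ?_⟩
  · exact (continuous_apply j).comp (continuous_subtype_val.comp continuous_subtype_val)
  · have := (Set.Definable.preimage_comp Fin.castSucc hD).inter
      (definable_setOf_eq (L := L) (M := M) (Fin.last m) (Fin.castSucc j))
    refine (congrArg (IsDef L) ?_).mp this
    ext y
    constructor
    · rintro ⟨hy, hl⟩
      refine ⟨⟨⟨_, hy⟩, trivial⟩, ?_⟩
      have hl : y (Fin.last m) = y (Fin.castSucc j) := hl
      change y = Fin.snoc (y ∘ Fin.castSucc) (y (Fin.castSucc j))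
      rw [← hl]
      exact (Fin.snoc_init_self y).symm
    · rintro ⟨x, rfl⟩
      constructor
      · change _ ∘ _ ∈ D
        convert x.1.2
        funext i
        simp
      · rw [Set.mem_ofPred_eq]
        simp

/-- The coordinates of `D ⊆ M ^ m` are sections, so that morphisms into `D` are continuous. -/
theorem Space.IsMorphism.continuous {h : T → D}
    (hh : IsMorphism (X := defSpace L T hT) (Y := defSpace L D hD) h) : Continuous h := by
  refine Continuous.subtype_mk (continuous_pi fun j => ?_) _
  exact (hh.isSection_coord j).1.comp (continuous_id.subtype_mk fun _ => trivial)

/-- The coordinates of `D ⊆ M ^ m` are sections, so that morphisms into `D` are definable. -/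
theorem Space.IsMorphism.isDefMap {h : T → D}
    (hh : IsMorphism (X := defSpace L T hT) (Y := defSpace L D hD) h) : IsDefMap L h := by
  refine isDefMap_of_coord hT fun j => ?_
  refine (congrArg (IsDef L) ?_).mp (hh.isSection_coord j).2
  ext y
  exact ⟨fun ⟨x, hx⟩ => ⟨x.1, hx⟩, fun ⟨x, hx⟩ => ⟨⟨x, trivial⟩, hx⟩⟩

/-- Maps that select coordinates (projections, inclusions) are morphisms. -/
theorem isMorphism_of_reindex {h : T → D} (c : Fin m → Fin n)
    (hc : ∀ x j, (h x).1 j = x.1 (c j)) :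
    IsMorphism (X := defSpace L T hT) (Y := defSpace L D hD) h := by
  refine (isDefMap_of_reindex hT c hc).isMorphism
    (Continuous.subtype_mk (continuous_pi fun j => ?_) _)
  simp only [hc]
  exact (continuous_apply (c j)).comp continuous_subtype_val

/-- An open definable subset `O` of `T`, as an open subspace of `T`, maps to `O` as a definable set
by a morphism. -/
theorem isMorphism_restrict_defSpace {O : Set T} (hO : (defSpace L T hT).top.IsOpen O) :
    IsMorphism (X := (defSpace L T hT).restrict O hO)
      (Y := defSpace L (Subtype.val '' O : Set (Fin n → M)) hO.2)
      fun x => ⟨x.1.1, x.1, x.2, rfl⟩ := by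
  set r : O → (Subtype.val '' O : Set (Fin n → M)) := fun x => ⟨x.1.1, x.1, x.2, rfl⟩
  have hc : Continuous r :=
    Continuous.subtype_mk (continuous_subtype_val.comp continuous_subtype_val) _
  have himg (V : Set (Subtype.val '' O : Set (Fin n → M))) :
      (Subtype.val '' (Subtype.val '' (r ⁻¹' V) : Set T) : Set (Fin n → M)) = Subtype.val '' V := by
    ext y
    constructor
    · rintro ⟨_, ⟨x, hx, rfl⟩, rfl⟩
      exact ⟨_, hx, rfl⟩
    · rintro ⟨⟨_, x, hx, rfl⟩, hV, rfl⟩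
      exact ⟨x, ⟨⟨x, hx⟩, hV, rfl⟩, rfl⟩
  have hpre (𝒲 : Set (Set (Subtype.val '' O : Set (Fin n → M)))) :
      ⋃₀ ((fun V : Set O => (Subtype.val '' V : Set T)) '' ((fun V => r ⁻¹' V) '' 𝒲)) =
        Subtype.val '' (r ⁻¹' ⋃₀ 𝒲) := by
    rw [sUnion_image_val, Set.sUnion_image, Set.preimage_sUnion]
  refine ⟨?_, ?_⟩
  · rintro 𝒱 ⟨hop, 𝒱₀, hsub, hfin, hun⟩
    refine ⟨?_, _, Set.image_mono (Set.image_mono hsub), (hfin.image _).image _, ?_⟩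
    · rintro _ ⟨_, ⟨V, hV, rfl⟩, rfl⟩
      refine ⟨hO.1.isOpenMap_subtype_val _ ((hop V hV).1.preimage hc), ?_⟩
      exact (congrArg (IsDef L) (himg V)).mpr (hop V hV).2
    · exact (hpre _).trans ((congrArg (fun V => Subtype.val '' (r ⁻¹' V)) hun).trans (hpre _).symm)
  · rintro (V : Set (Subtype.val '' O : Set (Fin n → M))) hV (s : V → M)
      (⟨hsc, hsd⟩ : Continuous s ∧ IsDef L (graph s))
    constructor
    · have ho : Continuous (ofImage (r ⁻¹' V)) :=
        Continuous.subtype_mk (Continuous.subtype_mk continuous_subtype_val _) _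
      exact hsc.comp ((hc.restrictPreimage (s := V)).comp ho)
    · refine (congrArg (IsDef L) ?_).mpr hsd
      ext y
      constructor
      · rintro ⟨⟨_, x, hx, rfl⟩, rfl⟩
        exact ⟨⟨r x, hx⟩, rfl⟩
      · rintro ⟨⟨⟨_, x, hx, rfl⟩, hV'⟩, rfl⟩
        exact ⟨⟨x, ⟨x, hx⟩, hV', rfl⟩, rfl⟩

end DefSpace

/-! ### Spaces generated by definable sets -/

variable (L) in
/-- A space is generated by definable sets if it carries the final structure for all morphisms
from definable sets to it. -/
structure IsGenerated (X : Space M) : Prop where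
  adm : ∀ 𝒲 : Set (Set X), (∀ (n : ℕ) (T : Set (Fin n → M)) (hT : IsDef L T)
    (t : defSpace L T hT → X), IsMorphism t →
      (defSpace L T hT).top.Adm ((fun W => t ⁻¹' W) '' 𝒲)) → X.top.Adm 𝒲
  mem_sections : ∀ (W : Set X) (hW : X.top.IsOpen W) (s : W → M),
    (∀ (n : ℕ) (T : Set (Fin n → M)) (hT : IsDef L T) (t : defSpace L T hT → X)
      (ht : IsMorphism t), s ∘ W.restrictPreimage t ∈
        (defSpace L T hT).sections (t ⁻¹' W) (ht.strict.isOpen_preimage hW)) →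
    s ∈ X.sections W hW

/-- Morphisms out of a generated space are tested on definable sets. -/
theorem IsGenerated.isMorphism {X Y : Space M} (hX : IsGenerated L X) {f : X → Y}
    (h : ∀ (n : ℕ) (T : Set (Fin n → M)) (hT : IsDef L T) (t : defSpace L T hT → X),
      IsMorphism t → IsMorphism fun x => f (t x)) : IsMorphism f := by
  have hs : StrictlyContinuous f := fun 𝒱 h𝒱 => hX.adm _ fun n T hT t ht =>
    Eq.mpr (congrArg (defSpace L T hT).top.Adm (Set.image_image _ _ _))
      ((h n T hT t ht).strict 𝒱 h𝒱)
  exact ⟨hs, fun V hV s hs => hX.mem_sections _ _ _ fun n T hT t ht =>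
    (h n T hT t ht).comp_mem V hV s hs⟩

theorem isGenerated_finalSpace {ι : Type u} (n : ι → ℕ) (T : ∀ i, Set (Fin (n i) → M))
    (hT : ∀ i, IsDef L (T i)) {C : Type u} (t : ∀ i, T i → C) :
    IsGenerated L (finalSpace (fun i => defSpace L (T i) (hT i)) C t) where
  adm _ h i := h _ _ (hT i) _ (isMorphism_finalSpace_mk (fun i => defSpace L (T i) (hT i)) t i)
  mem_sections _ _ _ h i :=
    h _ _ (hT i) _ (isMorphism_finalSpace_mk (fun i => defSpace L (T i) (hT i)) t i)

/-- Open subspaces of generated spaces are generated. -/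
theorem IsGenerated.restrict {X : Space M} (hX : IsGenerated L X) {U : Set X}
    (hU : X.top.IsOpen U) : IsGenerated L (X.restrict U hU) := by
  -- A test map `t` of `X` restricts to a test map of `U`, defined on the definable set `t⁻¹(U)`.
  have key (n : ℕ) (T : Set (Fin n → M)) (hT : IsDef L T) (t : defSpace L T hT → X)
      (ht : IsMorphism t) (hO : (defSpace L T hT).top.IsOpen (t ⁻¹' U)) :
      IsMorphism (X := defSpace L (Subtype.val '' (t ⁻¹' U) : Set (Fin n → M)) hO.2)
        (Y := X.restrict U hU) fun y => ⟨t ⟨y.1, by obtain ⟨_, x, _, rfl⟩ := y; exact x.2⟩, by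
          obtain ⟨_, x, hx, rfl⟩ := y; exact hx⟩ :=
    IsMorphism.of_val (ht.comp (isMorphism_of_reindex id fun _ _ => rfl))
  have himg {n : ℕ} {T : Set (Fin n → M)} {hT : IsDef L T} (t : defSpace L T hT → X)
      (W : Set U) : (Subtype.val '' {x : t ⁻¹' U | (⟨t x.1, x.2⟩ : U) ∈ W}) =
        t ⁻¹' (Subtype.val '' W) := by
    ext x
    constructor
    · rintro ⟨x, hx, rfl⟩
      exact ⟨_, hx, rfl⟩
    · rintro ⟨y, hy, hyx⟩
      have hxU : t x ∈ U := hyx ▸ y.2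
      have hxy : (⟨t x, hxU⟩ : U) = y := Subtype.ext hyx.symm
      exact ⟨⟨x, hxU⟩, show (⟨t x, hxU⟩ : U) ∈ W from hxy ▸ hy, rfl⟩
  constructor
  · intro 𝒲 H
    refine hX.adm _ fun n T hT t ht => ?_
    have hO := ht.strict.isOpen_preimage hU
    have h : (defSpace L T hT).top.Adm _ := (isMorphism_restrict_defSpace hO).strict _
      (H _ _ hO.2 _ (key n T hT t ht hO))
    refine Eq.mp (congrArg (defSpace L T hT).top.Adm ?_) h
    refine (Set.image_image _ _ _).trans ((Set.image_image _ _ _).trans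
      (Eq.trans ?_ (Set.image_image _ _ _).symm))
    exact Set.image_congr fun W _ => himg t W
  · intro W hW s H
    refine hX.mem_sections _ _ _ fun n T hT t ht => ?_
    have hO := ht.strict.isOpen_preimage hU
    have hr := isMorphism_restrict_defSpace hO
    have ht' := key n T hT t ht hO
    have h := hr.comp_mem _ (ht'.strict.isOpen_preimage hW) _ (H _ _ hO.2 _ ht')
    exact (defSpace L T hT).sections_congr (himg t W)
      (hr.strict.isOpen_preimage (ht'.strict.isOpen_preimage hW)) _ (fun _ _ _ => rfl) h

theorem IsLocallyDefinable.isGenerated {X : Space M} (hX : IsLocallyDefinable L X) :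
    IsGenerated L X := by
  obtain ⟨𝒰, h𝒰, hcov, haff⟩ := hX
  constructor
  · intro 𝒲 H
    refine X.top.adm_of_covering h𝒰 hcov fun U hU => ?_
    obtain ⟨hUo, n, D, hD, ⟨φ⟩⟩ := haff U hU
    have h : X.top.Adm _ := (isMorphism_toFun φ.hom).strict _ (H n D hD _
      ((X.isMorphism_val hUo).comp (isMorphism_toFun φ.inv)))
    refine Eq.mp (congrArg X.top.Adm ?_) h
    refine (Set.image_image _ _ _).trans ((Set.image_image _ _ _).trans (Set.image_congr ?_))
    intro W _
    refine Eq.trans ?_ (Subtype.image_preimage_coe U W)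
    congr 1
    ext x
    exact (congrArg (fun y : U => y.1 ∈ W) (iso_hom_inv φ x)).to_iff
  · intro W hW s H
    refine X.mem_sections_of_covering h𝒰 hcov hW fun U hU => ?_
    obtain ⟨hUo, n, D, hD, ⟨φ⟩⟩ := haff U hU
    have ht := (X.isMorphism_val hUo).comp (isMorphism_toFun φ.inv)
    have hφ := isMorphism_toFun φ.hom
    have h := hφ.comp_mem _ (ht.strict.isOpen_preimage hW) _ (H n D hD _ ht)
    refine X.sections_congr ?_ (hφ.strict.isOpen_preimage (ht.strict.isOpen_preimage hW)) _ ?_ h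
    · refine Eq.trans ?_ ((Subtype.image_preimage_coe U W).trans (Set.inter_comm _ _))
      congr 1
      ext x
      exact (congrArg (fun y : U => y.1 ∈ W) (iso_hom_inv φ x)).to_iff
    · rintro x ⟨y, hy, rfl⟩ hx
      refine congrArg s (Subtype.ext ?_)
      exact congrArg (fun y : U => y.1) (iso_hom_inv φ y)

section DefSpace

variable {n m k : ℕ} {D D' : Set (Fin m → M)} {E : Set (Fin k → M)}
  {hD : IsDef L D} {hD' : IsDef L D'} {hE : IsDef L E} {X : Space M}

/-- On a generated space, being a morphism into a definable set `D` does not depend on `D`. -/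
theorem IsGenerated.isMorphism_congr_codomain (hX : IsGenerated L X) {a : X → defSpace L D hD}
    (ha : IsMorphism a) {h : X → defSpace L D' hD'} (hh : ∀ x, (h x).1 = (a x).1) :
    IsMorphism h := by
  refine hX.isMorphism fun n T hT t ht => ?_
  have hat := ha.comp ht
  refine (hat.isDefMap.congr_codomain fun x => hh (t x)).isMorphism ?_
  refine Topology.IsInducing.subtypeVal.continuous_iff.mpr ?_
  convert continuous_subtype_val.comp hat.continuous using 1
  exact funext fun x => hh (t x)

theorem continuous_of_append {T : Type*} [TopologicalSpace T] {a : T → D} {b : T → E}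
    (ha : Continuous a) (hb : Continuous b) {h : T → prodSet D E}
    (hh : ∀ x, (h x).1 = Fin.append (a x).1 (b x).1) : Continuous h := by
  refine Topology.IsInducing.subtypeVal.continuous_iff.mpr (continuous_pi fun j => ?_)
  simp only [Function.comp_apply, hh]
  refine Fin.addCases (fun j => ?_) (fun j => ?_) j
  · simp only [Fin.append_left]
    exact (continuous_apply j).comp (continuous_subtype_val.comp ha)
  · simp only [Fin.append_right]
    exact (continuous_apply j).comp (continuous_subtype_val.comp hb)

/-- On a generated space, the pairing of two morphisms into definable sets is a morphism. -/
theorem IsGenerated.isMorphism_pair (hX : IsGenerated L X) {a : X → defSpace L D hD}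
    {b : X → defSpace L E hE} (ha : IsMorphism a) (hb : IsMorphism b)
    {h : X → defSpace L (prodSet D E) (isDef_prodSet hD hE)}
    (hh : ∀ x, (h x).1 = Fin.append (a x).1 (b x).1) : IsMorphism h := by
  refine hX.isMorphism fun n T hT t ht => ?_
  have hat := ha.comp ht
  have hbt := hb.comp ht
  refine (hat.isDefMap.pair hbt.isDefMap fun x => hh (t x)).isMorphism ?_
  exact continuous_of_append hat.continuous hbt.continuous fun x => hh (t x)

variable (L) in
theorem isLocallyDefinable_defSpace (D : Set (Fin m → M)) (hD : IsDef L D) :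
    IsLocallyDefinable L (defSpace L D hD) := by
  refine ⟨{Set.univ}, (defSpace L D hD).top.adm_of_finite (Set.finite_singleton _) ?_,
    Set.sUnion_singleton _, ?_⟩
  · rintro _ rfl
    exact (defSpace L D hD).top.isOpen_univ
  · rintro _ rfl
    have hU := (defSpace L D hD).top.isOpen_univ
    exact ⟨hU, m, D, hD, ⟨((defSpace L D hD).isMorphism_val hU).iso
      (g := fun x => ⟨x, trivial⟩) (IsMorphism.of_val (isMorphism_id _)) (fun _ => rfl)
      fun _ => rfl⟩⟩

variable (L) in
/-- A definable set as an object of the category of locally definable spaces. -/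
def defLDS (D : Set (Fin m → M)) (hD : IsDef L D) : LDS L M :=
  ⟨defSpace L D hD, isLocallyDefinable_defSpace L D hD⟩

end DefSpace

end Definable

end LocDef

namespace LocDef

open Space

section Definable

variable {L : FirstOrder.Language.{v, w}} {M : Type u} [L.Structure M] [TopologicalSpace M]

/-! ### Points -/

variable (L M) in
/-- The one-point definable set `M ^ 0`. -/
def point : LDS L M :=
  defLDS L (Set.univ : Set (Fin 0 → M)) Set.definable_univ

instance : Subsingleton (Set.univ : Set (Fin 0 → M)) :=
  ⟨fun _ _ => Subtype.ext (Subsingleton.elim _ _)⟩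

instance : Subsingleton (point L M).obj.carrier :=
  inferInstanceAs (Subsingleton (Set.univ : Set (Fin 0 → M)))

theorem isMorphism_of_point {X : Space M} (f : (point L M).obj → X) : IsMorphism f := by
  have hstr : StrictlyContinuous f := by
    intro 𝒱 _
    refine (point L M).obj.top.adm_of_finite (Set.toFinite _) fun U _ => ?_
    obtain rfl | hne := U.eq_empty_or_nonempty
    · exact (point L M).obj.top.isOpen_empty
    · rw [Subsingleton.eq_univ_of_nonempty hne]
      exact (point L M).obj.top.isOpen_univ
  refine ⟨hstr, fun V _ s _ => ?_⟩
  have key (O : Set (Set.univ : Set (Fin 0 → M))) (t : O → M) :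
      Continuous t ∧ IsDef L (graph t) := by
    refine ⟨continuous_of_const fun x y => congrArg t (Subsingleton.elim x y), ?_⟩
    have hsub : (graph t).Subsingleton := by
      rintro _ ⟨x, rfl⟩ _ ⟨y, rfl⟩
      rw [Subsingleton.elim x y]
    obtain h | ⟨a, h⟩ := hsub.eq_empty_or_singleton
    · rw [h]; exact Set.definable_empty
    · rw [h]; exact isDef_singleton a
  exact key _ _

/-! ### Products -/

/-- `P` with `p₁`, `p₂` is carried by the product of the sets `X` and `Y`, and maps from definable
sets to `P` are morphisms as soon as their two components are. -/
structure IsProductMap (L : FirstOrder.Language.{v, w}) [L.Structure M] {X Y P : Space M}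
    (p₁ : P → X) (p₂ : P → Y) : Prop where
  fst : IsMorphism p₁
  snd : IsMorphism p₂
  bijective : Function.Bijective fun z => (p₁ z, p₂ z)
  isMorphism : ∀ (n : ℕ) (T : Set (Fin n → M)) (hT : IsDef L T) (t : defSpace L T hT → P),
    IsMorphism (fun x => p₁ (t x)) → IsMorphism (fun x => p₂ (t x)) → IsMorphism t

section Charts

variable {X Y P : Space M} {p₁ : P → X} {p₂ : P → Y} {U : Set X} {V : Set Y}
  {hU : X.top.IsOpen U} {hV : Y.top.IsOpen V} {n m : ℕ} {D : Set (Fin n → M)}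
  {E : Set (Fin m → M)} {hD : IsDef L D} {hE : IsDef L E}

/-- The product of two charts is a chart. Its inverse is a morphism because its components are. -/
theorem IsProductMap.exists_chart (hP : IsProductMap L p₁ p₂) (hg : IsGenerated L P)
    (hbox : P.top.IsOpen (p₁ ⁻¹' U ∩ p₂ ⁻¹' V)) (φ : X.restrict U hU ≅ defSpace L D hD)
    (ψ : Y.restrict V hV ≅ defSpace L E hE) :
    ∃ e : P.restrict (p₁ ⁻¹' U ∩ p₂ ⁻¹' V) hbox ≅ defSpace L (prodSet D E) (isDef_prodSet hD hE),
      ∀ z : ↥(p₁ ⁻¹' U ∩ p₂ ⁻¹' V), (e.hom.toFun z).1 =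
        Fin.append (φ.hom.toFun ⟨p₁ z.1, z.2.1⟩).1 (ψ.hom.toFun ⟨p₂ z.1, z.2.2⟩).1 := by
  have hval := P.isMorphism_val hbox
  have ha : IsMorphism (X := P.restrict _ hbox) (Y := defSpace L D hD) fun z =>
      φ.hom.toFun ⟨p₁ z.1, z.2.1⟩ :=
    (isMorphism_toFun φ.hom).comp_codRestrict (hP.fst.comp hval) _
  have hb : IsMorphism (X := P.restrict _ hbox) (Y := defSpace L E hE) fun z =>
      ψ.hom.toFun ⟨p₂ z.1, z.2.2⟩ :=
    (isMorphism_toFun ψ.hom).comp_codRestrict (hP.snd.comp hval) _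
  have he : IsMorphism (X := P.restrict _ hbox)
      (Y := defSpace L (prodSet D E) (isDef_prodSet hD hE)) fun z =>
        ⟨_, append_mem_prodSet (φ.hom.toFun ⟨p₁ z.1, z.2.1⟩) (ψ.hom.toFun ⟨p₂ z.1, z.2.2⟩)⟩ :=
    (hg.restrict hbox).isMorphism_pair ha hb fun _ => rfl
  choose g hg' using fun x y => hP.bijective.2 (x, y)
  have hg₁ x y : p₁ (g x y) = x := congrArg Prod.fst (hg' x y)
  have hg₂ x y : p₂ (g x y) = y := congrArg Prod.snd (hg' x y)
  -- The components of the inverse of the chart.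
  set c : defSpace L (prodSet D E) (isDef_prodSet hD hE) → X.restrict U hU := fun y =>
    φ.inv.toFun ⟨_, y.2.1⟩
  set d : defSpace L (prodSet D E) (isDef_prodSet hD hE) → Y.restrict V hV := fun y =>
    ψ.inv.toFun ⟨_, y.2.2⟩
  have hcm : IsMorphism c := (isMorphism_toFun φ.inv).comp
    (isMorphism_of_reindex (Fin.castAdd m) fun _ _ => rfl)
  have hdm : IsMorphism d := (isMorphism_toFun ψ.inv).comp
    (isMorphism_of_reindex (Fin.natAdd n) fun _ _ => rfl)
  have hinv : IsMorphism (X := defSpace L (prodSet D E) (isDef_prodSet hD hE))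
      (Y := P.restrict _ hbox) fun y => ⟨g (c y).1 (d y).1, by
        show p₁ _ ∈ U
        rw [hg₁]; exact (c y).2, by
        show p₂ _ ∈ V
        rw [hg₂]; exact (d y).2⟩ := by
    refine IsMorphism.of_val (hP.isMorphism _ _ _ _ ?_ ?_)
    · simp only [hg₁]
      exact (X.isMorphism_val hU).comp hcm
    · simp only [hg₂]
      exact (Y.isMorphism_val hV).comp hdm
  refine ⟨he.iso hinv (fun z => Subtype.ext (hP.bijective.1 ?_)) (fun y => Subtype.ext ?_),
    fun z => rfl⟩
  · refine (hg' _ _).trans (Prod.ext ?_ ?_)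
    · have : c ⟨_, append_mem_prodSet (φ.hom.toFun ⟨p₁ z.1, z.2.1⟩)
          (ψ.hom.toFun ⟨p₂ z.1, z.2.2⟩)⟩ = ⟨p₁ z.1, z.2.1⟩ := by
        refine Eq.trans (congrArg φ.inv.toFun (Subtype.ext ?_)) (iso_hom_inv φ _)
        exact funext fun i => Fin.append_left _ _ i
      exact congrArg Subtype.val this
    · have : d ⟨_, append_mem_prodSet (φ.hom.toFun ⟨p₁ z.1, z.2.1⟩)
          (ψ.hom.toFun ⟨p₂ z.1, z.2.2⟩)⟩ = ⟨p₂ z.1, z.2.2⟩ := by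
        refine Eq.trans (congrArg ψ.inv.toFun (Subtype.ext ?_)) (iso_hom_inv ψ _)
        exact funext fun i => Fin.append_right _ _ i
      exact congrArg Subtype.val this
  · have h₁ : φ.hom.toFun ⟨p₁ (g (c y).1 (d y).1), (hg₁ _ _).symm ▸ (c y).2⟩ = ⟨_, y.2.1⟩ :=
      (congrArg φ.hom.toFun (Subtype.ext (hg₁ _ _))).trans (iso_inv_hom φ _)
    have h₂ : ψ.hom.toFun ⟨p₂ (g (c y).1 (d y).1), (hg₂ _ _).symm ▸ (d y).2⟩ = ⟨_, y.2.2⟩ :=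
      (congrArg ψ.hom.toFun (Subtype.ext (hg₂ _ _))).trans (iso_inv_hom ψ _)
    refine Eq.trans (congrArg₂ Fin.append (congrArg Subtype.val h₁) (congrArg Subtype.val h₂)) ?_
    exact Fin.append_castAdd_natAdd (f := y.1)

/-- Given a product chart, a map into its domain is a morphism if its components are. -/
theorem isMorphism_of_product_chart {T : Space M} (hT : IsGenerated L T)
    {hbox : P.top.IsOpen (p₁ ⁻¹' U ∩ p₂ ⁻¹' V)} (φ : X.restrict U hU ≅ defSpace L D hD)
    (ψ : Y.restrict V hV ≅ defSpace L E hE)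
    (e : P.restrict (p₁ ⁻¹' U ∩ p₂ ⁻¹' V) hbox ≅ defSpace L (prodSet D E) (isDef_prodSet hD hE))
    (he : ∀ z : ↥(p₁ ⁻¹' U ∩ p₂ ⁻¹' V), (e.hom.toFun z).1 =
      Fin.append (φ.hom.toFun ⟨p₁ z.1, z.2.1⟩).1 (ψ.hom.toFun ⟨p₂ z.1, z.2.2⟩).1)
    {t : T → P} (ha : IsMorphism fun x => p₁ (t x)) (hb : IsMorphism fun x => p₂ (t x))
    (ht : ∀ x, t x ∈ p₁ ⁻¹' U ∩ p₂ ⁻¹' V) : IsMorphism t := by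
  have ha' : IsMorphism (Y := defSpace L D hD) fun x => φ.hom.toFun ⟨p₁ (t x), (ht x).1⟩ :=
    (isMorphism_toFun φ.hom).comp_codRestrict ha _
  have hb' : IsMorphism (Y := defSpace L E hE) fun x => ψ.hom.toFun ⟨p₂ (t x), (ht x).2⟩ :=
    (isMorphism_toFun ψ.hom).comp_codRestrict hb _
  have h : IsMorphism fun x => e.hom.toFun ⟨t x, ht x⟩ :=
    hT.isMorphism_pair ha' hb' fun x => he ⟨t x, ht x⟩
  have h' := (P.isMorphism_val hbox).comp ((isMorphism_toFun e.inv).comp h)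
  exact (congrArg IsMorphism (funext fun x =>
    congrArg (fun z : ↥(p₁ ⁻¹' U ∩ p₂ ⁻¹' V) => z.1) (iso_hom_inv e ⟨t x, ht x⟩))).mp h'

end Charts

/-! ### Subspaces -/

/-- `i` is injective, and maps from definable sets to `W` are morphisms as soon as their
composites with `i` are. -/
structure IsSubspaceMap (L : FirstOrder.Language.{v, w}) [L.Structure M] {W X : Space M}
    (i : W → X) : Prop where
  map : IsMorphism i
  injective : Function.Injective i
  isMorphism : ∀ (n : ℕ) (T : Set (Fin n → M)) (hT : IsDef L T) (t : defSpace L T hT → W),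
    IsMorphism (fun x => i (t x)) → IsMorphism t

section Charts

variable {W X : Space M} {i : W → X} {U : Set X} {hU : X.top.IsOpen U} {n : ℕ}
  {D : Set (Fin n → M)} {hD : IsDef L D}

/-- A chart of the ambient space restricts to a chart of a subspace with definable trace. -/
theorem IsSubspaceMap.exists_chart (hi : IsSubspaceMap L i) (hg : IsGenerated L W)
    (φ : X.restrict U hU ≅ defSpace L D hD) {S : Set X} (hS : Set.range i = S)
    (hC : IsDef L (chartImage L φ S)) (hV : W.top.IsOpen (i ⁻¹' U)) :
    ∃ e : W.restrict (i ⁻¹' U) hV ≅ defSpace L (chartImage L φ S) hC,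
      ∀ x : ↥(i ⁻¹' U), (e.hom.toFun x).1 = (φ.hom.toFun ⟨i x.1, x.2⟩).1 := by
  subst hS
  have ha : IsMorphism (X := W.restrict _ hV) (Y := defSpace L D hD) fun x =>
      φ.hom.toFun ⟨i x.1, x.2⟩ :=
    (isMorphism_toFun φ.hom).comp_codRestrict (hi.map.comp (W.isMorphism_val hV)) _
  have he : IsMorphism (X := W.restrict _ hV) (Y := defSpace L (chartImage L φ (Set.range i)) hC)
      fun x => ⟨(φ.hom.toFun ⟨i x.1, x.2⟩).1, ⟨i x.1, x.2⟩, ⟨x.1, rfl⟩, rfl⟩ :=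
    (hg.restrict hV).isMorphism_congr_codomain ha fun _ => rfl
  have hsub : chartImage L φ (Set.range i) ⊆ D := by
    rintro _ ⟨x, -, rfl⟩
    exact (φ.hom.toFun x).2
  set c : defSpace L (chartImage L φ (Set.range i)) hC → X.restrict U hU := fun y =>
    φ.inv.toFun ⟨y.1, hsub y.2⟩
  have hcm : IsMorphism c := (isMorphism_toFun φ.inv).comp
    (isMorphism_of_reindex id fun _ _ => rfl)
  have hcr (y) : ∃ z, i z = (c y).1 := by
    obtain ⟨_, x, ⟨z, hz⟩, rfl⟩ := y
    exact ⟨z, hz.trans (congrArg (fun y : U => y.1) (iso_hom_inv φ x)).symm⟩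
  choose g hg' using hcr
  have hinv : IsMorphism (X := defSpace L (chartImage L φ (Set.range i)) hC)
      (Y := W.restrict _ hV) fun y => ⟨g y, by
        show i _ ∈ U
        rw [hg']; exact (c y).2⟩ := by
    refine IsMorphism.of_val (hi.isMorphism _ _ _ _ ?_)
    simp only [hg']
    exact (X.isMorphism_val hU).comp hcm
  refine ⟨he.iso hinv (fun z => Subtype.ext (hi.injective ?_)) (fun y => Subtype.ext ?_),
    fun z => rfl⟩
  · exact (hg' _).trans (congrArg (fun y : U => y.1) (iso_hom_inv φ ⟨i z.1, z.2⟩))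
  · have h : φ.hom.toFun ⟨i (g y), (hg' y).symm ▸ (c y).2⟩ = ⟨y.1, hsub y.2⟩ :=
      (congrArg φ.hom.toFun (Subtype.ext (hg' y))).trans (iso_inv_hom φ _)
    exact congrArg (fun d : D => d.1) h

/-- Given a subspace chart, a map into its domain is a morphism if it is one into the ambient
space. -/
theorem isMorphism_of_subspace_chart {T : Space M} (hT : IsGenerated L T)
    (φ : X.restrict U hU ≅ defSpace L D hD) {S : Set X} {hC : IsDef L (chartImage L φ S)}
    {hV : W.top.IsOpen (i ⁻¹' U)}
    (e : W.restrict (i ⁻¹' U) hV ≅ defSpace L (chartImage L φ S) hC)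
    (he : ∀ x : ↥(i ⁻¹' U), (e.hom.toFun x).1 = (φ.hom.toFun ⟨i x.1, x.2⟩).1)
    {t : T → W} (ha : IsMorphism fun x => i (t x)) (ht : ∀ x, t x ∈ i ⁻¹' U) : IsMorphism t := by
  have ha' : IsMorphism (Y := defSpace L D hD) fun x => φ.hom.toFun ⟨i (t x), ht x⟩ :=
    (isMorphism_toFun φ.hom).comp_codRestrict ha _
  have h : IsMorphism fun x => e.hom.toFun ⟨t x, ht x⟩ :=
    hT.isMorphism_congr_codomain ha' fun x => he ⟨t x, ht x⟩
  have h' := (W.isMorphism_val hV).comp ((isMorphism_toFun e.inv).comp h)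
  exact (congrArg IsMorphism (funext fun x =>
    congrArg (fun z : ↥(i ⁻¹' U) => z.1) (iso_hom_inv e ⟨t x, ht x⟩))).mp h'

end Charts

/-! ### Equalizer sets -/

/-- The set on which two morphisms from a definable set to a locally definable space agree is
definable: finitely many affine open subspaces suffice to cover the image of the first morphism, and
where the two morphisms agree they take values in the same one. -/
theorem isDef_eqLocus {n : ℕ} {D : Set (Fin n → M)} {hD : IsDef L D} {Z : Space M}
    (hZ : IsLocallyDefinable L Z) {a b : defSpace L D hD → Z} (ha : IsMorphism a)
    (hb : IsMorphism b) : IsDef L (Subtype.val '' {x : D | a x = b x}) := by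
  obtain ⟨𝒲, h𝒲, hcov, haff⟩ := hZ
  obtain ⟨-, 𝒲', hsub, hfin, hun⟩ := ha.strict 𝒲 h𝒲
  obtain ⟨𝒲₀, h𝒲₀, hfin₀, rfl⟩ := Set.exists_subset_image_finite_and.mp ⟨𝒲', hsub, hfin, rfl⟩
  have key (W : Set Z) (hW : W ∈ 𝒲) :
      IsDef L (Subtype.val '' {x : D | a x ∈ W ∧ a x = b x}) := by
    obtain ⟨hWo, m, E, hE, ⟨χ⟩⟩ := haff W hW
    -- On `O = a⁻¹(W) ∩ b⁻¹(W)` a chart `χ` of `W` turns `a` and `b` into definable maps.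
    have hO : (defSpace L D hD).top.IsOpen (a ⁻¹' W ∩ b ⁻¹' W) :=
      (defSpace L D hD).top.isOpen_inter (ha.strict.isOpen_preimage hWo)
        (hb.strict.isOpen_preimage hWo)
    set O : Set (Fin n → M) := Subtype.val '' (a ⁻¹' W ∩ b ⁻¹' W)
    have hOD (y : O) : ∃ h : y.1 ∈ D, (⟨y.1, h⟩ : D) ∈ a ⁻¹' W ∩ b ⁻¹' W := by
      obtain ⟨_, x, hx, rfl⟩ := y
      exact ⟨x.2, hx⟩
    have hincl : IsMorphism (X := defSpace L O hO.2) (Y := defSpace L D hD)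
        fun y => ⟨y.1, (hOD y).1⟩ := isMorphism_of_reindex id fun _ _ => rfl
    have ha' : IsMorphism (X := defSpace L O hO.2) (Y := defSpace L E hE)
        fun y => χ.hom.toFun ⟨a ⟨y.1, (hOD y).1⟩, (hOD y).2.1⟩ :=
      (isMorphism_toFun χ.hom).comp_codRestrict (ha.comp hincl) _
    have hb' : IsMorphism (X := defSpace L O hO.2) (Y := defSpace L E hE)
        fun y => χ.hom.toFun ⟨b ⟨y.1, (hOD y).1⟩, (hOD y).2.2⟩ :=
      (isMorphism_toFun χ.hom).comp_codRestrict (hb.comp hincl) _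
    refine (congrArg (IsDef L) ?_).mp (ha'.isDefMap.isDef_eq hb'.isDefMap)
    ext y
    constructor
    · rintro ⟨x, hx, rfl⟩
      have h := (iso_hom_inv χ _).symm.trans
        ((congrArg χ.inv.toFun hx).trans (iso_hom_inv χ _))
      exact ⟨⟨x.1, (hOD x).1⟩, ⟨(hOD x).2.1, congrArg Subtype.val h⟩, rfl⟩
    · rintro ⟨x, ⟨hx, hab⟩, rfl⟩
      refine ⟨⟨x.1, x, ⟨hx, show b x ∈ W from hab ▸ hx⟩, rfl⟩, ?_, rfl⟩
      exact congrArg χ.hom.toFun (Subtype.ext hab)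
  have := hfin₀.to_subtype
  have h := Set.definable_iUnion_of_finite fun W : 𝒲₀ => key W.1 (h𝒲₀ W.2)
  refine (congrArg (IsDef L) ?_).mp h
  ext y
  rw [Set.mem_iUnion]
  constructor
  · rintro ⟨W, x, hx, rfl⟩
    exact ⟨x, hx.2, rfl⟩
  · rintro ⟨x, hx, rfl⟩
    obtain ⟨W, hW, hxW⟩ := hcov.ge (Set.mem_univ (a x))
    obtain ⟨_, ⟨W', hW', rfl⟩, hxW'⟩ := hun.ge (Set.mem_sUnion_of_mem (show x ∈ a ⁻¹' W from hxW)
      (Set.mem_image_of_mem _ hW))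
    exact ⟨⟨W', hW'⟩, x, ⟨hxW', hx⟩, rfl⟩

theorem isLocallyDefinableSet_eqLocus {X Z : LDS L M} (a b : X ⟶ Z) :
    IsLocallyDefinableSet X {x | LDS.map a x = LDS.map b x} := by
  intro U hU n D hD φ
  have ht := (X.obj.isMorphism_val hU).comp (isMorphism_toFun φ.inv)
  refine (congrArg (IsDef L) ?_).mp (isDef_eqLocus Z.property
    ((isMorphism_toFun a.hom).comp ht) ((isMorphism_toFun b.hom).comp ht))
  ext y
  constructor
  · rintro ⟨d, hd, rfl⟩
    exact ⟨φ.inv.toFun d, hd, congrArg Subtype.val (iso_inv_hom φ d).symm⟩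
  · rintro ⟨x, hx, rfl⟩
    refine ⟨φ.hom.toFun x, ?_, rfl⟩
    exact (congrArg (fun z : U => LDS.map a z.1 = LDS.map b z.1) (iso_hom_inv φ x)).mpr hx

end Definable

end LocDef

namespace LocDef

open Space

section Definable

variable {L : FirstOrder.Language.{v, w}} {M : Type u} [L.Structure M] [TopologicalSpace M]

/-! ### Products in the category of locally definable spaces -/

namespace LDS

variable {X Y Z : LDS L M}

theorem hom_ext {f g : X ⟶ Y} (h : ∀ x, LDS.map f x = LDS.map g x) : f = g :=
  ObjectProperty.hom_ext _ (Hom.ext (funext h))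

theorem isMorphism_map (f : X ⟶ Y) : IsMorphism (LDS.map f) :=
  isMorphism_toFun f.hom

theorem isGenerated (X : LDS L M) : IsGenerated L X.obj :=
  IsLocallyDefinable.isGenerated X.property

/-- The morphism of locally definable spaces with a given underlying map. -/
def ofMap {f : X.obj → Y.obj} (hf : IsMorphism f) : X ⟶ Y :=
  ObjectProperty.homMk hf.hom

/-- The morphism from the one-point space given by a point. -/
def ofPoint (x : X.obj) : point L M ⟶ X :=
  ofMap (isMorphism_of_point fun _ => x)

variable (L M) in
/-- The point of the one-point space. -/
def pt : (point L M).obj :=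
  (⟨Fin.elim0, trivial⟩ : (Set.univ : Set (Fin 0 → M)))

end LDS

section Products

variable {X Y P : LDS L M} {p₁ : P ⟶ X} {p₂ : P ⟶ Y}

/-- A product in the category has the product as underlying set, because points are morphisms from
`M ^ 0`. -/
theorem IsProduct.isProductMap (h : IsProduct p₁ p₂) :
    IsProductMap L (LDS.map p₁) (LDS.map p₂) := by
  obtain ⟨h⟩ := h
  have hinj : Function.Injective fun z => (LDS.map p₁ z, LDS.map p₂ z) := by
    intro z z' hz
    have he : LDS.ofPoint z = LDS.ofPoint z' := BinaryFan.IsLimit.hom_ext h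
      (LDS.hom_ext fun _ => congrArg Prod.fst hz) (LDS.hom_ext fun _ => congrArg Prod.snd hz)
    exact congrArg (fun f => LDS.map f (LDS.pt L M)) he
  have hlift {T : LDS L M} (a : T ⟶ X) (b : T ⟶ Y) :
      ∃ l : T ⟶ P, ∀ x, (LDS.map p₁ (LDS.map l x), LDS.map p₂ (LDS.map l x)) =
        (LDS.map a x, LDS.map b x) := by
    obtain ⟨l, rfl, rfl⟩ := BinaryFan.IsLimit.lift' h a b
    exact ⟨l, fun _ => rfl⟩
  refine ⟨LDS.isMorphism_map p₁, LDS.isMorphism_map p₂, ⟨hinj, fun ⟨x, y⟩ => ?_⟩, ?_⟩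
  · obtain ⟨l, hl⟩ := hlift (LDS.ofPoint x) (LDS.ofPoint y)
    exact ⟨_, hl (LDS.pt L M)⟩
  · intro n T hT t ha hb
    obtain ⟨l, hl⟩ := hlift (LDS.ofMap (X := defLDS L T hT) ha)
      (LDS.ofMap (X := defLDS L T hT) hb)
    exact (congrArg IsMorphism (funext fun x => hinj (hl x))).mp (LDS.isMorphism_map l)

theorem IsProductMap.isProduct (h : IsProductMap L (LDS.map p₁) (LDS.map p₂)) :
    IsProduct p₁ p₂ := by
  choose g hg using fun x y => h.bijective.2 (x, y)
  have hg₁ x y : LDS.map p₁ (g x y) = x := congrArg Prod.fst (hg x y)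
  have hg₂ x y : LDS.map p₂ (g x y) = y := congrArg Prod.snd (hg x y)
  have hl {T : LDS L M} (a : T ⟶ X) (b : T ⟶ Y) :
      IsMorphism fun x => g (LDS.map a x) (LDS.map b x) := by
    refine T.isGenerated.isMorphism fun n D hD t ht => h.isMorphism _ _ _ _ ?_ ?_
    · simp only [hg₁]
      exact (LDS.isMorphism_map a).comp ht
    · simp only [hg₂]
      exact (LDS.isMorphism_map b).comp ht
  refine ⟨BinaryFan.isLimitMk (fun s => LDS.ofMap (hl s.fst s.snd))
    (fun s => LDS.hom_ext fun x => hg₁ _ _) (fun s => LDS.hom_ext fun x => hg₂ _ _)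
    fun s m h₁ h₂ => LDS.hom_ext fun x => h.bijective.1 ((Prod.ext ?_ ?_).trans (hg _ _).symm)⟩
  · exact congrArg (fun f => LDS.map f x) h₁
  · exact congrArg (fun f => LDS.map f x) h₂

variable {𝒰 : Set (Set X.obj)} {𝒱 : Set (Set Y.obj)}

theorem IsProductMap.isAdmissibleUnionOfProducts (h𝒰 : IsAffineCovering L X.obj 𝒰)
    (h𝒱 : IsAffineCovering L Y.obj 𝒱) (h : IsProductMap L (LDS.map p₁) (LDS.map p₂)) :
    IsAdmissibleUnionOfProducts 𝒰 𝒱 p₁ p₂ where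
  bijective := h.bijective
  adm := adm_image2_preimage h.fst h.snd h𝒰.1 h𝒱.1
  cover := sUnion_image2_preimage h𝒰.2.1 h𝒱.2.1
  affine _ _ _ _ _ _ _ _ _ _ _ _ φ ψ := h.exists_chart P.isGenerated _ φ ψ

theorem IsAdmissibleUnionOfProducts.isProductMap (h𝒰 : IsAffineCovering L X.obj 𝒰)
    (h𝒱 : IsAffineCovering L Y.obj 𝒱) (h : IsAdmissibleUnionOfProducts 𝒰 𝒱 p₁ p₂) :
    IsProductMap L (LDS.map p₁) (LDS.map p₂) := by
  refine ⟨LDS.isMorphism_map p₁, LDS.isMorphism_map p₂, h.bijective, fun n T hT t ha hb => ?_⟩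
  refine isMorphism_of_covering (adm_image2_preimage ha hb h𝒰.1 h𝒱.1)
    (sUnion_image2_preimage h𝒰.2.1 h𝒱.2.1) ?_
  rintro _ ⟨U, hU, V, hV, rfl⟩
  obtain ⟨hUo, n, D, hD, ⟨φ⟩⟩ := h𝒰.2.2 U hU
  obtain ⟨hVo, m, E, hE, ⟨ψ⟩⟩ := h𝒱.2.2 V hV
  obtain ⟨e, he⟩ := h.affine U hU V hV hUo hVo n m D E hD hE φ ψ
  have hval := (defSpace L T hT).isMorphism_val
    ((defSpace L T hT).top.isOpen_inter (ha.strict.isOpen_preimage hUo)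
      (hb.strict.isOpen_preimage hVo))
  exact isMorphism_of_product_chart ((defLDS L T hT).isGenerated.restrict _) φ ψ e he
    (ha.comp hval) (hb.comp hval) fun x => x.2

end Products

/-! ### Subspaces and fiber products -/

section Subspaces

variable {W X : LDS L M} {i : W ⟶ X}

theorem IsSubspaceMap.isSubspace (h : IsSubspaceMap L (LDS.map i)) {S : Set X.obj}
    (hS : Set.range (LDS.map i) = S) (hdef : IsLocallyDefinableSet X S) : IsSubspace i S where
  injective := h.injective
  range_eq := hS
  locallyDefinable := hdef
  affine _ _ _ _ _ φ := h.exists_chart W.isGenerated φ hS _ _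

theorem IsSubspace.isSubspaceMap {S : Set X.obj} (h : IsSubspace i S) :
    IsSubspaceMap L (LDS.map i) := by
  refine ⟨LDS.isMorphism_map i, h.injective, fun n T hT t ht => ?_⟩
  obtain ⟨𝒰, h𝒰, hcov, haff⟩ := X.property
  refine isMorphism_of_covering (ht.strict 𝒰 h𝒰) (sUnion_image_preimage hcov) ?_
  rintro _ ⟨U, hU, rfl⟩
  obtain ⟨hUo, n, D, hD, ⟨φ⟩⟩ := haff U hU
  obtain ⟨e, he⟩ := h.affine U hUo n D hD φ
  exact isMorphism_of_subspace_chart ((defLDS L T hT).isGenerated.restrict _) φ e he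
    (ht.comp ((defSpace L T hT).isMorphism_val (ht.strict.isOpen_preimage hUo))) fun x => x.2

/-- Morphisms with values in the image of a subspace map factor through it. -/
theorem IsSubspaceMap.exists_lift (h : IsSubspaceMap L (LDS.map i)) {T : LDS L M} (a : T ⟶ X)
    (ha : ∀ x, LDS.map a x ∈ Set.range (LDS.map i)) : ∃ l : T ⟶ W, l ≫ i = a := by
  choose g hg using ha
  have hl : IsMorphism g := by
    refine T.isGenerated.isMorphism fun n D hD t ht => h.isMorphism _ _ _ _ ?_
    simp only [hg]
    exact (LDS.isMorphism_map a).comp ht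
  exact ⟨LDS.ofMap hl, LDS.hom_ext hg⟩

theorem IsSubspaceMap.mono (h : IsSubspaceMap L (LDS.map i)) : Mono i :=
  ⟨fun _ _ hab => LDS.hom_ext fun x => h.injective (congrArg (fun f => LDS.map f x) hab)⟩

end Subspaces

section Pullbacks

variable {W X Y Z P : LDS L M} {f : X ⟶ Z} {g : Y ⟶ Z} {p₁ : P ⟶ X} {p₂ : P ⟶ Y} {i : W ⟶ P}

/-- A fiber product is, as a set, the equalizer set in `X × Y`, because points are morphisms from
`M ^ 0`; and its universal property for definable sets makes it a subspace. -/
theorem isSubspaceMap_of_isPullback (hP : IsProduct p₁ p₂)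
    (h : IsPullback (i ≫ p₁) (i ≫ p₂) f g) :
    IsSubspaceMap L (LDS.map i) ∧
      Set.range (LDS.map i) = {z | LDS.map (p₁ ≫ f) z = LDS.map (p₂ ≫ g) z} := by
  have hP := hP.isProductMap
  have hinj : Function.Injective (LDS.map i) := by
    intro x y hxy
    have he : LDS.ofPoint x = LDS.ofPoint y := h.hom_ext
      (LDS.hom_ext fun _ => congrArg (LDS.map p₁) hxy)
      (LDS.hom_ext fun _ => congrArg (LDS.map p₂) hxy)
    exact congrArg (fun f => LDS.map f (LDS.pt L M)) he
  have hlift {T : LDS L M} (a : T.obj → P.obj) (ha₁ : IsMorphism fun x => LDS.map p₁ (a x))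
      (ha₂ : IsMorphism fun x => LDS.map p₂ (a x))
      (hfg : ∀ x, LDS.map f (LDS.map p₁ (a x)) = LDS.map g (LDS.map p₂ (a x))) :
      ∃ l : T ⟶ W, ∀ x, LDS.map i (LDS.map l x) = a x := by
    refine ⟨h.lift (LDS.ofMap ha₁) (LDS.ofMap ha₂) (LDS.hom_ext hfg), fun x => ?_⟩
    refine hP.bijective.1 (Prod.ext ?_ ?_)
    · exact congrArg (fun f => LDS.map f x) (h.lift_fst _ _ (LDS.hom_ext hfg))
    · exact congrArg (fun f => LDS.map f x) (h.lift_snd _ _ (LDS.hom_ext hfg))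
  refine ⟨⟨LDS.isMorphism_map i, hinj, fun n T hT t ht => ?_⟩, Set.Subset.antisymm ?_ ?_⟩
  · obtain ⟨l, hl⟩ := hlift (T := defLDS L T hT) (fun x => LDS.map i (t x)) (hP.fst.comp ht)
      (hP.snd.comp ht) fun x => congrArg (fun f => LDS.map f (t x)) h.w
    exact (congrArg IsMorphism (funext fun x => hinj (hl x))).mp (LDS.isMorphism_map l)
  · rintro _ ⟨x, rfl⟩
    exact congrArg (fun f => LDS.map f x) h.w
  · intro z hz
    obtain ⟨l, hl⟩ := hlift (T := point L M) (fun _ => z) (isMorphism_of_point _)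
      (isMorphism_of_point _) fun _ => hz
    exact ⟨_, hl (LDS.pt L M)⟩

theorem IsSubspaceMap.isPullback (hP : IsProduct p₁ p₂) (h : IsSubspaceMap L (LDS.map i))
    (hr : Set.range (LDS.map i) = {z | LDS.map (p₁ ≫ f) z = LDS.map (p₂ ≫ g) z}) :
    IsPullback (i ≫ p₁) (i ≫ p₂) f g := by
  obtain ⟨hP⟩ := hP
  have hw : (i ≫ p₁) ≫ f = (i ≫ p₂) ≫ g := LDS.hom_ext fun x => hr.le ⟨x, rfl⟩
  have hlift (s : PullbackCone f g) : ∃ l : s.pt ⟶ W, l ≫ i ≫ p₁ = s.fst ∧ l ≫ i ≫ p₂ = s.snd := by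
    obtain ⟨a, ha₁, ha₂⟩ := BinaryFan.IsLimit.lift' hP s.fst s.snd
    have ha₁ : a ≫ p₁ = s.fst := ha₁
    have ha₂ : a ≫ p₂ = s.snd := ha₂
    obtain ⟨l, rfl⟩ := h.exists_lift a fun x => hr.ge (by
      have hs := s.condition
      rw [← ha₁, ← ha₂] at hs
      exact congrArg (fun f => LDS.map f x) hs)
    exact ⟨l, by simpa using ha₁, by simpa using ha₂⟩
  choose l hl₁ hl₂ using hlift
  have := h.mono
  refine ⟨⟨hw⟩, ⟨PullbackCone.IsLimit.mk hw l hl₁ hl₂ fun s m h₁ h₂ => ?_⟩⟩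
  rw [← cancel_mono i]
  refine BinaryFan.IsLimit.hom_ext hP ?_ ?_
  · simpa [hl₁] using h₁
  · simpa [hl₂] using h₂

end Pullbacks

/-! ### Existence of finite limits -/

section Existence

/-- The final structure on a set `C` for a class `𝒯` of maps from definable sets to `C`. -/
def testSpace (C : Type u)
    (𝒯 : ∀ (n : ℕ) (T : Set (Fin n → M)) (_ : IsDef L T), (T → C) → Prop) : Space M :=
  finalSpace
    (ι := Σ (n : ℕ) (T : {T : Set (Fin n → M) // IsDef L T}), {t : T.1 → C // 𝒯 n T.1 T.2 t})
    (fun i => defSpace L i.2.1.1 i.2.1.2) C fun i => i.2.2.1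

variable {C : Type u} {𝒯 : ∀ (n : ℕ) (T : Set (Fin n → M)) (_ : IsDef L T), (T → C) → Prop}

theorem isGenerated_testSpace : IsGenerated L (testSpace C 𝒯) :=
  isGenerated_finalSpace _ _ _ _

theorem isMorphism_testSpace_of_mem {n : ℕ} {T : Set (Fin n → M)} {hT : IsDef L T} {t : T → C}
    (ht : 𝒯 n T hT t) : IsMorphism (X := defSpace L T hT) (Y := testSpace C 𝒯) t :=
  isMorphism_finalSpace_mk
    (ι := Σ (n : ℕ) (T : {T : Set (Fin n → M) // IsDef L T}), {t : T.1 → C // 𝒯 n T.1 T.2 t})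
    (fun i => defSpace L i.2.1.1 i.2.1.2) (fun i => i.2.2.1) ⟨n, ⟨T, hT⟩, ⟨t, ht⟩⟩

theorem isMorphism_of_testSpace {Y : Space M} {f : C → Y}
    (h : ∀ (n : ℕ) (T : Set (Fin n → M)) (hT : IsDef L T) (t : T → C), 𝒯 n T hT t →
      IsMorphism (X := defSpace L T hT) fun x => f (t x)) :
    IsMorphism (X := testSpace C 𝒯) f :=
  isMorphism_of_finalSpace _ _ fun i => h i.1 i.2.1.1 i.2.1.2 i.2.2.1 i.2.2.2

/-- The set `X × Y` with the final structure for all maps from definable sets whose two components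
are morphisms. -/
def productSpace (L : FirstOrder.Language.{v, w}) [L.Structure M] (X Y : Space M) : Space M :=
  testSpace (L := L) (X × Y) fun _ T hT t =>
    IsMorphism (X := defSpace L T hT) (fun x => (t x).1) ∧
      IsMorphism (X := defSpace L T hT) fun x => (t x).2

theorem isProductMap_productSpace (X Y : Space M) :
    IsProductMap L (P := productSpace L X Y) (X := X) (Y := Y) Prod.fst Prod.snd where
  fst := isMorphism_of_testSpace fun _ _ _ _ ht => ht.1
  snd := isMorphism_of_testSpace fun _ _ _ _ ht => ht.2
  bijective := Function.bijective_id
  isMorphism _ _ _ _ h₁ h₂ := isMorphism_testSpace_of_mem ⟨h₁, h₂⟩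

theorem isLocallyDefinable_productSpace {X Y : Space M} (hX : IsLocallyDefinable L X)
    (hY : IsLocallyDefinable L Y) : IsLocallyDefinable L (productSpace L X Y) := by
  obtain ⟨𝒰, h𝒰, hU, haffU⟩ := hX
  obtain ⟨𝒱, h𝒱, hV, haffV⟩ := hY
  have h := isProductMap_productSpace (L := L) X Y
  have hadm := adm_image2_preimage h.fst h.snd h𝒰 h𝒱
  refine ⟨_, hadm, sUnion_image2_preimage hU hV, fun O hO =>
    ⟨(productSpace L X Y).top.isOpen_of_mem hadm hO, ?_⟩⟩
  obtain ⟨U, hU, V, hV, rfl⟩ := hO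
  obtain ⟨hUo, n, D, hD, ⟨φ⟩⟩ := haffU U hU
  obtain ⟨hVo, m, E, hE, ⟨ψ⟩⟩ := haffV V hV
  obtain ⟨e, -⟩ := h.exists_chart isGenerated_testSpace _ φ ψ
  exact ⟨_, _, _, ⟨e⟩⟩

theorem exists_isProduct (X Y : LDS L M) :
    ∃ (P : LDS L M) (p₁ : P ⟶ X) (p₂ : P ⟶ Y), IsProduct p₁ p₂ := by
  have h := isProductMap_productSpace (L := L) X.obj Y.obj
  exact ⟨⟨productSpace L X.obj Y.obj, isLocallyDefinable_productSpace X.property Y.property⟩,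
    LDS.ofMap h.fst, LDS.ofMap h.snd, IsProductMap.isProduct h⟩

/-- A subset `S` of `X` with the final structure for all maps from definable sets which are
morphisms into `X`. -/
def subSpace (L : FirstOrder.Language.{v, w}) [L.Structure M] (X : Space M) (S : Set X) : Space M :=
  testSpace (L := L) S fun _ T hT t => IsMorphism (X := defSpace L T hT) (Y := X) fun x => (t x).1

theorem isSubspaceMap_subSpace (X : Space M) (S : Set X) :
    IsSubspaceMap L (W := subSpace L X S) (X := X) Subtype.val where
  map := isMorphism_of_testSpace fun _ _ _ _ ht => ht
  injective := Subtype.val_injective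
  isMorphism _ _ _ _ h := isMorphism_testSpace_of_mem h

theorem isLocallyDefinable_subSpace {X : LDS L M} {S : Set X.obj}
    (hS : IsLocallyDefinableSet X S) : IsLocallyDefinable L (subSpace L X.obj S) := by
  obtain ⟨𝒰, h𝒰, hcov, haff⟩ := X.property
  have h := isSubspaceMap_subSpace (L := L) X.obj S
  have hadm := h.map.strict 𝒰 h𝒰
  refine ⟨_, hadm, sUnion_image_preimage hcov, fun O hO =>
    ⟨(subSpace L X.obj S).top.isOpen_of_mem hadm hO, ?_⟩⟩
  obtain ⟨U, hU, rfl⟩ := hO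
  obtain ⟨hUo, n, D, hD, ⟨φ⟩⟩ := haff U hU
  obtain ⟨e, -⟩ := h.exists_chart isGenerated_testSpace φ Subtype.range_coe
    (hS U hUo n D hD φ) (h.map.strict.isOpen_preimage hUo)
  exact ⟨_, _, _, ⟨e⟩⟩

theorem exists_isSubspaceMap {X : LDS L M} {S : Set X.obj} (hS : IsLocallyDefinableSet X S) :
    ∃ (W : LDS L M) (i : W ⟶ X), IsSubspaceMap L (LDS.map i) ∧ Set.range (LDS.map i) = S :=
  have h := isSubspaceMap_subSpace (L := L) X.obj S
  ⟨⟨subSpace L X.obj S, isLocallyDefinable_subSpace hS⟩, LDS.ofMap h.map, h, Subtype.range_coe⟩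

variable (L M) in
theorem hasFiniteLimits : HasFiniteLimits (LDS L M) := by
  have hterm : HasTerminal (LDS L M) := by
    refine IsTerminal.hasTerminal (X := point L M) (IsTerminal.ofUniqueHom (fun X =>
      LDS.ofMap (f := fun _ => LDS.pt L M) ?_) fun X m => ?_)
    · exact X.isGenerated.isMorphism fun n T hT t _ =>
        isMorphism_of_reindex (Fin.elim0) fun _ j => j.elim0
    · exact LDS.hom_ext fun x => Subsingleton.elim (α := (point L M).obj.carrier) _ _
  have hprod : HasBinaryProducts (LDS L M) := by
    have (X Y : LDS L M) : HasLimit (pair X Y) := by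
      obtain ⟨P, p₁, p₂, ⟨h⟩⟩ := exists_isProduct X Y
      exact ⟨⟨⟨_, h⟩⟩⟩
    exact hasBinaryProducts_of_hasLimit_pair _
  have heq : HasEqualizers (LDS L M) := by
    have (X Y : LDS L M) (f g : X ⟶ Y) : HasLimit (parallelPair f g) := by
      obtain ⟨W, i, h, hr⟩ := exists_isSubspaceMap (isLocallyDefinableSet_eqLocus f g)
      have hw : i ≫ f = i ≫ g := LDS.hom_ext fun x => hr.le ⟨x, rfl⟩
      have := h.mono
      refine ⟨⟨⟨Fork.ofι i hw, Fork.IsLimit.ofExistsUnique fun s => ?_⟩⟩⟩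
      obtain ⟨l, hl⟩ := h.exists_lift s.ι fun x =>
        hr.ge (congrArg (fun f => LDS.map f x) s.condition)
      exact ⟨l, hl, fun m hm => (cancel_mono i).mp (hm.trans hl.symm)⟩
    exact hasEqualizers_of_hasLimit_parallelPair _
  have := hasFiniteProducts_of_has_binary_and_terminal (C := LDS L M)
  exact hasFiniteLimits_of_hasEqualizers_and_finite_products

end Existence

end Definable

end LocDef

theorem mainTheorem9 (L : FirstOrder.Language.{v, w}) (M : Type u) [L.Structure M]
    [TopologicalSpace M] :
    HasFiniteLimits (LocDef.LDS L M) ∧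
    (∀ (X Y : LocDef.LDS L M) (𝒰 : Set (Set X.obj)) (𝒱 : Set (Set Y.obj)),
      LocDef.IsAffineCovering L X.obj 𝒰 → LocDef.IsAffineCovering L Y.obj 𝒱 →
      ∀ (P : LocDef.LDS L M) (p₁ : P ⟶ X) (p₂ : P ⟶ Y),
        LocDef.IsProduct p₁ p₂ ↔ LocDef.IsAdmissibleUnionOfProducts 𝒰 𝒱 p₁ p₂) ∧
    (∀ (X Y Z : LocDef.LDS L M) (f : X ⟶ Z) (g : Y ⟶ Z)
      (P : LocDef.LDS L M) (p₁ : P ⟶ X) (p₂ : P ⟶ Y)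
      (Q : LocDef.LDS L M) (q₁ q₂ : Q ⟶ Z) (k : P ⟶ Q),
      LocDef.IsProduct p₁ p₂ → LocDef.IsProduct q₁ q₂ → k ≫ q₁ = p₁ ≫ f → k ≫ q₂ = p₂ ≫ g →
      LocDef.IsLocallyDefinableSet Q (LocDef.diagonal q₁ q₂) ∧
      LocDef.IsLocallyDefinableSet P (LocDef.LDS.map k ⁻¹' LocDef.diagonal q₁ q₂) ∧
      ∀ (W : LocDef.LDS L M) (i : W ⟶ P),
        IsPullback (i ≫ p₁) (i ≫ p₂) f g ↔
          LocDef.IsSubspace i (LocDef.LDS.map k ⁻¹' LocDef.diagonal q₁ q₂)) := by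
  refine ⟨LocDef.hasFiniteLimits L M, fun X Y 𝒰 𝒱 h𝒰 h𝒱 P p₁ p₂ => ⟨fun h => ?_, fun h => ?_⟩,
    fun X Y Z f g P p₁ p₂ Q q₁ q₂ k hP hQ h₁ h₂ => ?_⟩
  · exact h.isProductMap.isAdmissibleUnionOfProducts h𝒰 h𝒱
  · exact (h.isProductMap h𝒰 h𝒱).isProduct
  · have hS : LocDef.LDS.map k ⁻¹' LocDef.diagonal q₁ q₂ =
        {z | LocDef.LDS.map (p₁ ≫ f) z = LocDef.LDS.map (p₂ ≫ g) z} := by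
      rw [← h₁, ← h₂]
      rfl
    rw [hS]
    have hdef := LocDef.isLocallyDefinableSet_eqLocus (p₁ ≫ f) (p₂ ≫ g)
    refine ⟨LocDef.isLocallyDefinableSet_eqLocus q₁ q₂, hdef, fun W i => ⟨fun h => ?_, fun h => ?_⟩⟩
    · obtain ⟨hi, hr⟩ := LocDef.isSubspaceMap_of_isPullback hP h
      exact hi.isSubspace hr hdef
    · exact h.isSubspaceMap.isPullback hP h.range_eq
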